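/- Let $\mathbb{K}$ be a field and let $Q$ be a finite connected quiver with $n\ge 2$ vertices (loops and multiple arrows are allowed). Let $J$ be the ideal of the path algebra $\mathbb{K}Q$ generated by the arrows, and let $A=\mathbb{K}Q/J^2$. Modules are finitely generated right $A$-modules; $\Omega^m(M)$ and $\Omega^{-m}(M)$ denote the $m$-th syzygy and cosyzygy of $M$ for a minimal projective resolution and a minimal injective coresolution, and $A_0=\mathbb{K}Q/J$ is the direct sum of the simple modules. Let $K_0$ be the free abelian group on symbols $[M]$, one for each isomorphism class of modules, modulo the relations $[M]=[M']+[M'']$ whenever $M\cong M'\oplus M''$, and $[P]=0$ for $P$ projective. Let $\overline{\Omega}:K_0\to K_0$ be the endomorphism with $\overline{\Omega}[M]=[\Omega(M)]$, and let $\langle \mathrm{add}\,M\rangle\subseteq K_0$ be the subgroup generated by the classes of the indecomposable direct summands of $M$. Put $$\phi(M)=\min\{l\in\mathbb{N}:\ \overline{\Omega}\text{ is injective on }\overline{\Omega}^{\,l+s}\langle \mathrm{add}\,M\rangle\text{ for all } s\in\mathbb{N}\},\qquad \phi\dim(A)=\sup_M \phi(M).$$ The heart of $Q$ is the full subquiver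 on the vertices $v$ (with idempotent $e_v$) such that $\Omega^n(A_0)e_v\ne0$ and $\Omega^{-n}(A_0)e_v\neq 0$; the member of $Q$ is the full subquiver on the remaining vertices. Let $\mathfrak{M}_Q$ be the adjacency matrix of $Q$, regarded as a complex matrix. Then $\phi\dim(A)=n$ if and only if the member of $Q$ is empty and, for some $\lambda\in\mathbb{C}$ with $\lambda\neq0$, the Jordan form of $\mathfrak{M}_Q$ consists of exactly two blocks: one block of size $n-1$ with eigenvalue $0$ and one $1\times1$ block $(\lambda)$. Moreover, whenever $\mathfrak{M}_Q$ has a Jordan form of this kind with $\lambda\neq 0$, $\lambda$ is the number of loops of $Q$. -/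

import Mathlib

universe u v w

noncomputable section

/-! ### Finitely generated modules modulo projectives, and the Igusa-Todorov function

`R` is a Noetherian ring and modules are left `R`-modules; right modules over an algebra `A` are
obtained by taking `R = Aᵐᵒᵖ`. -/

namespace IgusaTodorov

section General

variable (R : Type u) [Ring R]

/-- The defining relations of `K₀`: `[M] - [M'] - [M'']` whenever `M ≅ M' ⊕ M''`, and `[P]` for
every (finitely generated) projective `P`. In particular isomorphic modules are identified. -/
def relations : Set (FreeAbelianGroup (FGModuleCat.{u} R)) :=
  {x | ∃ M M' M'' : FGModuleCat.{u} R, Nonempty (M ≃ₗ[R] (M' × M'')) ∧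
      x = FreeAbelianGroup.of M - FreeAbelianGroup.of M' - FreeAbelianGroup.of M''} ∪
    {x | ∃ P : FGModuleCat.{u} R, Module.Projective R P ∧ x = FreeAbelianGroup.of P}

/-- The group `K₀`: the free abelian group on finitely generated modules modulo `relations`. -/
abbrev K0 : Type (u + 1) :=
  FreeAbelianGroup (FGModuleCat.{u} R) ⧸ AddSubgroup.closure (relations R)

variable {R}

/-- The class `[M]` of a finitely generated module in `K₀`. -/
def cls (M : FGModuleCat.{u} R) : K0 R :=
  QuotientAddGroup.mk' _ (FreeAbelianGroup.of M)

theorem cls_prod {M M' M'' : FGModuleCat.{u} R} (e : M ≃ₗ[R] (M' × M'')) :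
    cls M = cls M' + cls M'' := by
  have h : (QuotientAddGroup.mk' (AddSubgroup.closure (relations R)))
      (FreeAbelianGroup.of M - FreeAbelianGroup.of M' - FreeAbelianGroup.of M'') = 0 :=
    (QuotientAddGroup.eq_zero_iff _).2
      (AddSubgroup.subset_closure (Or.inl ⟨M, M', M'', ⟨e⟩, rfl⟩))
  rw [map_sub, map_sub, sub_sub, sub_eq_zero] at h
  exact h

theorem cls_projective {P : FGModuleCat.{u} R} (h : Module.Projective R P) : cls P = 0 :=
  (QuotientAddGroup.eq_zero_iff _).2 (AddSubgroup.subset_closure (Or.inr ⟨P, h, rfl⟩))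

theorem cls_congr {M N : FGModuleCat.{u} R} (e : M ≃ₗ[R] N) : cls M = cls N := by
  let Z : FGModuleCat.{u} R := FGModuleCat.of R PUnit.{u + 1}
  have hZ : cls Z = 0 :=
    cls_projective (P := Z) (inferInstanceAs (Module.Projective R PUnit.{u + 1}))
  have e' : M ≃ₗ[R] (N × Z) := e.trans (LinearEquiv.prodUnique (M₂ := PUnit.{u + 1})).symm
  rw [cls_prod e', hZ, add_zero]

/-- `π : P → M` is a projective cover: `P` is projective, `π` is onto, and the kernel of `π` is
superfluous. -/
def IsProjectiveCover {P M : FGModuleCat.{u} R} (π : P →ₗ[R] M) : Prop :=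
  Module.Projective R P ∧ Function.Surjective π ∧
    ∀ N : Submodule R P, N ⊔ LinearMap.ker π = ⊤ → N = ⊤

/-- `ι : M → E` is an injective envelope: `E` is injective, `ι` is one-to-one, and its image is
essential. -/
def IsInjectiveEnvelope {M E : FGModuleCat.{u} R} (ι : M →ₗ[R] E) : Prop :=
  Module.Injective R E ∧ Function.Injective ι ∧
    ∀ N : Submodule R E, N ⊓ LinearMap.range ι = ⊥ → N = ⊥

/-- `N ≅ Ω(M)`: `N` is isomorphic to the kernel of a projective cover of `M`. -/
def IsSyzygy (M N : FGModuleCat.{u} R) : Prop :=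
  ∃ (P : FGModuleCat.{u} R) (π : P →ₗ[R] M), IsProjectiveCover π ∧
    Nonempty (N ≃ₗ[R] LinearMap.ker π)

/-- `N ≅ Ω⁻¹(M)`: `N` is isomorphic to the cokernel of an injective envelope of `M`. -/
def IsCosyzygy (M N : FGModuleCat.{u} R) : Prop :=
  ∃ (E : FGModuleCat.{u} R) (ι : M →ₗ[R] E), IsInjectiveEnvelope ι ∧
    Nonempty (N ≃ₗ[R] (E ⧸ LinearMap.range ι))

/-- `N ≅ Ωⁿ(M)`, the `n`-th syzygy for a minimal projective resolution. -/
def IsNthSyzygy : ℕ → FGModuleCat.{u} R → FGModuleCat.{u} R → Prop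
  | 0, M, N => Nonempty (M ≃ₗ[R] N)
  | n + 1, M, N => ∃ L, IsSyzygy M L ∧ IsNthSyzygy n L N

/-- `N ≅ Ω⁻ⁿ(M)`, the `n`-th cosyzygy for a minimal injective coresolution. -/
def IsNthCosyzygy : ℕ → FGModuleCat.{u} R → FGModuleCat.{u} R → Prop
  | 0, M, N => Nonempty (M ≃ₗ[R] N)
  | n + 1, M, N => ∃ L, IsCosyzygy M L ∧ IsNthCosyzygy n L N

/-- An indecomposable module: nonzero, and not a direct sum of two nonzero modules. -/
def IsIndecomposable (M : FGModuleCat.{u} R) : Prop :=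
  Nontrivial M ∧ ∀ X Y : FGModuleCat.{u} R, Nonempty (M ≃ₗ[R] (X × Y)) →
    Subsingleton X ∨ Subsingleton Y

/-- `⟨add M⟩`: the subgroup of `K₀` generated by the classes of the indecomposable direct
summands of `M`. -/
def addSpan (M : FGModuleCat.{u} R) : AddSubgroup (K0 R) :=
  AddSubgroup.closure {x | ∃ N L : FGModuleCat.{u} R, IsIndecomposable N ∧
    Nonempty (M ≃ₗ[R] (N × L)) ∧ x = cls N}

/-- Schanuel's lemma. -/
def schanuel {M P Q : Type u} [AddCommGroup M] [AddCommGroup P] [AddCommGroup Q]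
    [Module R M] [Module R P] [Module R Q] (f : P →ₗ[R] M) (g : Q →ₗ[R] M)
    (s : P →ₗ[R] Q) (hs : ∀ p, g (s p) = f p) (t : Q →ₗ[R] P) (ht : ∀ q, f (t q) = g q) :
    (LinearMap.ker f × Q) ≃ₗ[R] (LinearMap.ker g × P) where
  toFun x := (⟨x.2 - s (x.1 + t x.2), by
    have h := x.1.2
    rw [LinearMap.mem_ker] at h
    rw [LinearMap.mem_ker, map_sub, hs, map_add, ht, h, zero_add, sub_self]⟩, x.1 + t x.2)
  invFun y := (⟨y.2 - t (y.1 + s y.2), by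
    have h := y.1.2
    rw [LinearMap.mem_ker] at h
    rw [LinearMap.mem_ker, map_sub, ht, map_add, hs, h, zero_add, sub_self]⟩, y.1 + s y.2)
  map_add' x y := by
    ext <;> simp <;> abel
  map_smul' r x := by
    ext <;> simp [smul_sub]
  left_inv x := by
    ext <;> simp
  right_inv y := by
    ext <;> simp

theorem exists_cover (M : FGModuleCat.{u} R) :
    ∃ (P : FGModuleCat.{u} R) (f : P →ₗ[R] M), Module.Projective R P ∧ Function.Surjective f := by
  obtain ⟨n, f, hf⟩ := Module.Finite.exists_fin' R M
  exact ⟨FGModuleCat.of R (Fin n → R), f, inferInstanceAs (Module.Projective R (Fin n → R)), hf⟩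

/-- The kernel of a direct sum of two linear maps. -/
def kerProdMapEquiv {M P M' P' : Type u} [AddCommGroup M] [AddCommGroup P] [AddCommGroup M']
    [AddCommGroup P'] [Module R M] [Module R P] [Module R M'] [Module R P']
    (f : P →ₗ[R] M) (f' : P' →ₗ[R] M') :
    LinearMap.ker (LinearMap.prodMap f f') ≃ₗ[R] (LinearMap.ker f × LinearMap.ker f') where
  toFun x := (⟨x.1.1, congrArg Prod.fst x.2⟩, ⟨x.1.2, congrArg Prod.snd x.2⟩)
  invFun y := ⟨(y.1.1, y.2.1), Prod.ext y.1.2 y.2.2⟩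
  map_add' _ _ := rfl
  map_smul' _ _ := rfl
  left_inv _ := rfl
  right_inv _ := rfl

variable [IsNoetherianRing R]

/-- The kernel of a linear map between finitely generated modules over a Noetherian ring. -/
def kerObj {P M : FGModuleCat.{u} R} (π : P →ₗ[R] M) : FGModuleCat.{u} R :=
  FGModuleCat.of R (LinearMap.ker π)

theorem cls_kerObj_eq {M P Q : FGModuleCat.{u} R} (f : P →ₗ[R] M) (g : Q →ₗ[R] M)
    (hP : Module.Projective R P) (hQ : Module.Projective R Q)
    (hf : Function.Surjective f) (hg : Function.Surjective g) :
    cls (kerObj f) = cls (kerObj g) := by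
  obtain ⟨s, hs⟩ := Module.projective_lifting_property g f hg
  obtain ⟨t, ht⟩ := Module.projective_lifting_property f g hf
  have e := schanuel f g s (fun p => LinearMap.congr_fun hs p) t
    (fun q => LinearMap.congr_fun ht q)
  have h1 := cls_prod (M := FGModuleCat.of R (kerObj f × Q)) (M' := kerObj f) (M'' := Q)
    (LinearEquiv.refl R _)
  have h2 := cls_prod (M := FGModuleCat.of R (kerObj f × Q)) (M' := kerObj g) (M'' := P) e
  rw [cls_projective hQ, add_zero] at h1
  rw [cls_projective hP, add_zero] at h2
  exact h1.symm.trans h2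

/-- The class in `K₀` of the kernel of some surjection from a projective module onto `M`; it does
not depend on the surjection. -/
def syzygyClass (M : FGModuleCat.{u} R) : K0 R :=
  cls (kerObj (exists_cover M).choose_spec.choose)

theorem syzygyClass_eq {M P : FGModuleCat.{u} R} (f : P →ₗ[R] M)
    (hP : Module.Projective R P) (hf : Function.Surjective f) :
    syzygyClass M = cls (kerObj f) :=
  cls_kerObj_eq _ _ (exists_cover M).choose_spec.choose_spec.1 hP
    (exists_cover M).choose_spec.choose_spec.2 hf

/-- The endomorphism `Ω̄` of `K₀` induced by `Ω`; see `omegaBar_cls`. -/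
def omegaBar : K0 R →+ K0 R :=
  QuotientAddGroup.lift _ (FreeAbelianGroup.lift syzygyClass) (by
    rw [AddSubgroup.closure_le]
    rintro x (⟨M, M', M'', ⟨e⟩, rfl⟩ | ⟨P, hP, rfl⟩)
    · obtain ⟨P', f', hP', hf'⟩ := exists_cover M'
      obtain ⟨P'', f'', hP'', hf''⟩ := exists_cover M''
      let P : FGModuleCat.{u} R := FGModuleCat.of R (P' × P'')
      have hP : Module.Projective R P := inferInstanceAs (Module.Projective R (P' × P''))
      let f : P →ₗ[R] M := e.symm.toLinearMap ∘ₗ LinearMap.prodMap f' f''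
      have hf : Function.Surjective f :=
        e.symm.surjective.comp (Function.Surjective.prodMap hf' hf'')
      have hk : LinearMap.ker f = LinearMap.ker (LinearMap.prodMap f' f'') :=
        LinearEquiv.ker_comp _ _
      have h := cls_prod (M := kerObj f) (M' := kerObj f') (M'' := kerObj f'')
        ((LinearEquiv.ofEq _ _ hk).trans (kerProdMapEquiv f' f''))
      simp [syzygyClass_eq f hP hf, syzygyClass_eq f' hP' hf', syzygyClass_eq f'' hP'' hf'', h]
    · have hk : Subsingleton (LinearMap.ker (LinearMap.id : P →ₗ[R] P)) := by
        rw [LinearMap.ker_id]; infer_instance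
      have h : cls (kerObj (LinearMap.id : P →ₗ[R] P)) = 0 :=
        cls_projective (inferInstanceAs
          (Module.Projective R (LinearMap.ker (LinearMap.id : P →ₗ[R] P))))
      simp [syzygyClass_eq (LinearMap.id : P →ₗ[R] P) hP Function.surjective_id, h])

/-- `Ω̄[M] = [Ω(M)]`. -/
theorem omegaBar_cls {M N : FGModuleCat.{u} R} (h : IsSyzygy M N) :
    omegaBar (cls M) = cls N := by
  obtain ⟨P, π, ⟨hP, hs, -⟩, ⟨e⟩⟩ := h
  have h1 : omegaBar (cls M) = syzygyClass M := by
    simp [omegaBar, cls]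
  rw [h1, syzygyClass_eq π hP hs]
  exact (cls_congr (N := kerObj π) e).symm

/-- The Igusa-Todorov function: `φ(M)` is the least `l` such that `Ω̄` is injective on
`Ω̄^(l+s)⟨add M⟩` for all `s` (and `⊤` if there were no such `l`). -/
def phi (M : FGModuleCat.{u} R) : ℕ∞ :=
  ⨅ l ∈ {l : ℕ | ∀ s : ℕ, Set.InjOn (omegaBar (R := R))
    ((omegaBar (R := R))^[l + s] '' (addSpan M : Set (K0 R)))}, (l : ℕ∞)

variable (R) in
/-- The `φ`-dimension: the supremum of `φ(M)` over all finitely generated modules `M`. -/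
def phiDim : ℕ∞ := ⨆ M : FGModuleCat.{u} R, phi M

end General

end IgusaTodorov

/-! ### Path algebras and radical square zero algebras -/

namespace QuiverAlgebra

open IgusaTodorov

open scoped Classical in
/-- The product of two paths as an element of the path algebra: first `p`, then `q`, if `p` ends
where `q` starts, and `0` otherwise. -/
def pathMul (K : Type w) [Field K] {V : Type u} [Quiver.{v + 1} V]
    (p q : Σ a b : V, Quiver.Path a b) : (Σ a b : V, Quiver.Path a b) →₀ K :=
  if h : p.2.1 = q.1 then
    Finsupp.single ⟨p.1, q.2.1, p.2.2.comp (q.2.2.cast h.symm rfl)⟩ 1 else 0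

/-- The path algebra `K Q` of a quiver `Q` with vertex set `V`: the vector space with basis the
set of all paths (including the trivial ones). -/
def PathAlgebra (K : Type w) [Field K] (V : Type u) [Quiver.{v + 1} V] : Type (max w u (v + 1)) :=
  (Σ a b : V, Quiver.Path a b) →₀ K

section

variable {K : Type w} [Field K] {V : Type u} [Quiver.{v + 1} V]

instance : AddCommGroup (PathAlgebra K V) :=
  inferInstanceAs (AddCommGroup ((Σ a b : V, Quiver.Path a b) →₀ K))

instance : Module K (PathAlgebra K V) :=
  inferInstanceAs (Module K ((Σ a b : V, Quiver.Path a b) →₀ K))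

/-- A path as a basis element of the path algebra. -/
def ofPath {a b : V} (p : Quiver.Path a b) : PathAlgebra K V :=
  Finsupp.single ⟨a, b, p⟩ (1 : K)

/-- Concatenation of paths, extended bilinearly. -/
def mulHom : PathAlgebra K V →ₗ[K] PathAlgebra K V →ₗ[K] PathAlgebra K V :=
  Finsupp.linearCombination K fun p => Finsupp.linearCombination K fun q => pathMul K p q

instance : Mul (PathAlgebra K V) := ⟨fun x y => mulHom x y⟩

theorem mul_def (x y : PathAlgebra K V) : x * y = mulHom x y := rfl

theorem mulHom_single (p q : Σ a b : V, Quiver.Path a b) :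
    (Finsupp.linearCombination K fun p => Finsupp.linearCombination K fun q => pathMul K p q)
      (Finsupp.single p 1) (Finsupp.single q 1) = pathMul K p q := by
  rw [Finsupp.linearCombination_single, one_smul, Finsupp.linearCombination_single, one_smul]

theorem ofPath_mul_ofPath {a b c : V} (p : Quiver.Path a b) (q : Quiver.Path b c) :
    (ofPath p * ofPath q : PathAlgebra K V) = ofPath (p.comp q) := by
  refine (mulHom_single _ _).trans ?_
  simp only [pathMul, dite_true, Quiver.Path.cast_rfl_rfl]
  rfl

theorem ofPath_mul_ofPath_of_ne {a b b' c : V} (p : Quiver.Path a b) (q : Quiver.Path b' c)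
    (h : b ≠ b') : (ofPath p * ofPath q : PathAlgebra K V) = 0 := by
  refine (mulHom_single _ _).trans ?_
  simp only [pathMul, h, dite_false]
  rfl

theorem induction_ofPath {motive : PathAlgebra K V → Prop} (x : PathAlgebra K V)
    (zero : motive 0) (add : ∀ x y, motive x → motive y → motive (x + y))
    (smul : ∀ (c : K) (x), motive x → motive (c • x))
    (path : ∀ (a b : V) (p : Quiver.Path a b), motive (ofPath p)) : motive x := by
  refine Finsupp.induction_linear (motive := motive) x zero add fun p c => ?_
  have h : (Finsupp.single p c : (Σ a b : V, Quiver.Path a b) →₀ K)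
      = c • Finsupp.single p (1 : K) := by simp
  rw [h]
  exact smul c _ (path p.1 p.2.1 p.2.2)

variable [Fintype V]

instance : One (PathAlgebra K V) := ⟨∑ v : V, ofPath (Quiver.Path.nil : Quiver.Path v v)⟩

theorem one_def : (1 : PathAlgebra K V) = ∑ v : V, ofPath (Quiver.Path.nil : Quiver.Path v v) :=
  rfl

instance : Ring (PathAlgebra K V) :=
  { (inferInstance : AddCommGroup (PathAlgebra K V)),
    (inferInstance : Mul (PathAlgebra K V)),
    (inferInstance : One (PathAlgebra K V)) with
    left_distrib := fun x y z => map_add (mulHom x) y z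
    right_distrib := fun x y z => by simp [mul_def]
    zero_mul := fun x => by simp [mul_def]
    mul_zero := fun x => by simp [mul_def]
    mul_assoc := fun x y z => by
      induction x using induction_ofPath with
      | zero => simp [mul_def]
      | add x x' hx hx' => simp only [mul_def, map_add, LinearMap.add_apply] at *; rw [hx, hx']
      | smul c x hx => simp only [mul_def, map_smul, LinearMap.smul_apply] at *; rw [hx]
      | path a b p =>
      induction y using induction_ofPath with
      | zero => simp [mul_def]
      | add x x' hx hx' => simp only [mul_def, map_add, LinearMap.add_apply] at *; rw [hx, hx']
      | smul c x hx => simp only [mul_def, map_smul, LinearMap.smul_apply] at *; rw [hx]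
      | path b' c q =>
      induction z using induction_ofPath with
      | zero => simp [mul_def]
      | add x x' hx hx' => simp only [mul_def, map_add] at *; rw [hx, hx']
      | smul c x hx => simp only [mul_def, map_smul] at *; rw [hx]
      | path c' d r =>
      by_cases h : b = b'
      · subst h
        by_cases h' : c = c'
        · subst h'
          simp only [ofPath_mul_ofPath, Quiver.Path.comp_assoc]
        · rw [ofPath_mul_ofPath, ofPath_mul_ofPath_of_ne _ _ h', ofPath_mul_ofPath_of_ne _ _ h']
          simp [mul_def]
      · rw [ofPath_mul_ofPath_of_ne _ _ h]
        by_cases h' : c = c'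
        · subst h'
          rw [ofPath_mul_ofPath, ofPath_mul_ofPath_of_ne _ _ h]
          simp [mul_def]
        · rw [ofPath_mul_ofPath_of_ne _ _ h']
          simp [mul_def]
    one_mul := fun x => by
      induction x using induction_ofPath with
      | zero => simp [mul_def]
      | add x x' hx hx' => simp only [mul_def, map_add] at *; rw [hx, hx']
      | smul c x hx => simp only [mul_def, map_smul] at *; rw [hx]
      | path a b p =>
      have h : (1 * ofPath p : PathAlgebra K V)
          = ∑ v : V, ofPath (Quiver.Path.nil : Quiver.Path v v) * ofPath p := by
        simp [mul_def, one_def]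
      rw [h, Finset.sum_eq_single a, ofPath_mul_ofPath, Quiver.Path.nil_comp]
      · exact fun v _ hv => ofPath_mul_ofPath_of_ne _ _ hv
      · simp
    mul_one := fun x => by
      induction x using induction_ofPath with
      | zero => simp [mul_def]
      | add x x' hx hx' =>
        simp only [mul_def, map_add, LinearMap.add_apply] at *; rw [hx, hx']
      | smul c x hx => simp only [mul_def, map_smul, LinearMap.smul_apply] at *; rw [hx]
      | path a b p =>
      have h : (ofPath p * 1 : PathAlgebra K V)
          = ∑ v : V, ofPath p * ofPath (Quiver.Path.nil : Quiver.Path v v) := by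
        simp [mul_def, one_def]
      rw [h, Finset.sum_eq_single b, ofPath_mul_ofPath, Quiver.Path.comp_nil]
      · exact fun v _ hv => ofPath_mul_ofPath_of_ne _ _ (Ne.symm hv)
      · simp }

instance : Algebra K (PathAlgebra K V) :=
  Algebra.ofModule (fun c x y => by simp [mul_def]) (fun c x y => by simp [mul_def])

variable (K V)

/-- The (two-sided) ideal `J` of the path algebra generated by the arrows. -/
def arrowIdeal : Ideal (PathAlgebra K V) :=
  (TwoSidedIdeal.span {x | ∃ (a b : V) (α : a ⟶ b), x = ofPath α.toPath}).asIdeal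

instance : (arrowIdeal K V).IsTwoSided :=
  inferInstanceAs (TwoSidedIdeal.asIdeal _).IsTwoSided

/-- The radical square zero algebra `K Q / J²`. -/
abbrev RadSqZero : Type (max w u (v + 1)) := PathAlgebra K V ⧸ (arrowIdeal K V * arrowIdeal K V)

variable {V} in
/-- The primitive idempotent `e_a` of `K Q / J²` given by the trivial path at the vertex `a`. -/
def idem (a : V) : RadSqZero K V :=
  Ideal.Quotient.mk _ (ofPath (Quiver.Path.nil : Quiver.Path a a))

variable {V} in
theorem ofPath_toPath_mem_arrowIdeal {a b : V} (α : a ⟶ b) :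
    (ofPath α.toPath : PathAlgebra K V) ∈ arrowIdeal K V :=
  TwoSidedIdeal.mem_asIdeal.2 (TwoSidedIdeal.subset_span ⟨a, b, α, rfl⟩)

instance finite_radSqZero [∀ a b : V, Fintype (a ⟶ b)] : Module.Finite K (RadSqZero K V) := by
  let g : V ⊕ (Σ a b : V, (a ⟶ b)) → RadSqZero K V :=
    Sum.elim (idem K) (fun α => Ideal.Quotient.mk _ (ofPath α.2.2.toPath))
  have hv : ∀ a : V, (Ideal.Quotient.mk ((arrowIdeal K V * arrowIdeal K V))
      (ofPath (Quiver.Path.nil : Quiver.Path a a))) ∈ Submodule.span K (Set.range g) :=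
    fun a => Submodule.subset_span ⟨Sum.inl a, rfl⟩
  have ha : ∀ (a b : V) (α : a ⟶ b), (Ideal.Quotient.mk ((arrowIdeal K V * arrowIdeal K V))
      (ofPath α.toPath)) ∈ Submodule.span K (Set.range g) :=
    fun a b α => Submodule.subset_span ⟨Sum.inr ⟨a, b, α⟩, rfl⟩
  refine ⟨Submodule.fg_def.2 ⟨Set.range g, Set.finite_range g, eq_top_iff.2 fun x _ => ?_⟩⟩
  obtain ⟨x, rfl⟩ := Ideal.Quotient.mk_surjective x
  clear * - hv ha
  induction x using induction_ofPath with
  | zero => rw [map_zero]; exact Submodule.zero_mem _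
  | add x y hx hy => rw [map_add]; exact Submodule.add_mem _ hx hy
  | smul c x hx => exact Submodule.smul_mem _ c hx
  | path a b p =>
    cases p with
    | nil => exact hv a
    | cons p α =>
      cases p with
      | nil => exact ha _ _ α
      | cons p β =>
        have h : (ofPath ((p.cons β).cons α) : PathAlgebra K V)
            = (ofPath p * ofPath β.toPath) * ofPath α.toPath := by
          rw [ofPath_mul_ofPath, ofPath_mul_ofPath]; rfl
        have h' : (ofPath ((p.cons β).cons α) : PathAlgebra K V) ∈ (arrowIdeal K V * arrowIdeal K V) := by
          rw [h]
          exact Ideal.mul_mem_mul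
            ((arrowIdeal K V).mul_mem_left _ (ofPath_toPath_mem_arrowIdeal K β))
            (ofPath_toPath_mem_arrowIdeal K α)
        rw [Ideal.Quotient.eq_zero_iff_mem.2 h']
        exact Submodule.zero_mem _

instance isNoetherianRing_op [∀ a b : V, Fintype (a ⟶ b)] :
    IsNoetherianRing (RadSqZero K V)ᵐᵒᵖ :=
  IsNoetherianRing.of_finite K (RadSqZero K V)ᵐᵒᵖ

/-- The radical `J / J²` of `A = K Q / J²`, as a right `A`-submodule of `A`. -/
def radSubmodule : Submodule (RadSqZero K V)ᵐᵒᵖ (RadSqZero K V) where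
  carrier := {x | ∃ y ∈ arrowIdeal K V,
    Ideal.Quotient.mk ((arrowIdeal K V * arrowIdeal K V)) y = x}
  zero_mem' := ⟨0, Ideal.zero_mem _, map_zero _⟩
  add_mem' := by
    rintro _ _ ⟨x, hx, rfl⟩ ⟨y, hy, rfl⟩
    exact ⟨x + y, Ideal.add_mem _ hx hy, map_add _ _ _⟩
  smul_mem' := by
    rintro r _ ⟨y, hy, rfl⟩
    obtain ⟨b, hb⟩ := Ideal.Quotient.mk_surjective (MulOpposite.unop r)
    refine ⟨y * b, Ideal.mul_mem_right b _ hy, ?_⟩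
    rw [map_mul, hb]
    rfl

/-- The right `A`-module `A₀ = K Q / J = A / (J / J²)`, the sum of all simple modules. -/
def semisimpleTop : FGModuleCat (RadSqZero K V)ᵐᵒᵖ :=
  haveI : Module.Finite (RadSqZero K V)ᵐᵒᵖ (RadSqZero K V) :=
    Module.Finite.of_surjective
      (LinearMap.toSpanSingleton (RadSqZero K V)ᵐᵒᵖ (RadSqZero K V) 1)
      (fun x => ⟨MulOpposite.op x, one_mul x⟩)
  FGModuleCat.of _ (RadSqZero K V ⧸ radSubmodule K V)

variable {K V} in
/-- The support of a right module `M`: the vertices `a` with `M e_a ≠ 0`. -/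
def support (M : FGModuleCat (RadSqZero K V)ᵐᵒᵖ) : Set V :=
  {a | ∃ x : M, MulOpposite.op (idem K a) • x ≠ 0}

/-- The vertices of the heart of `Q`: those in the support of both `Ωⁿ(A₀)` and `Ω⁻ⁿ(A₀)`, where
`n` is the number of vertices. -/
def heart : Set V :=
  {a | (∃ N, IsNthSyzygy (Fintype.card V) (semisimpleTop K V) N ∧ a ∈ support N) ∧
    (∃ N, IsNthCosyzygy (Fintype.card V) (semisimpleTop K V) N ∧ a ∈ support N)}

/-- The vertices of the member of `Q`: those which are not in the heart. -/
def member : Set V := (heart K V)ᶜ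

/-- The adjacency matrix of a finite quiver: the entry `(a, b)` is the number of arrows from `a`
to `b`. -/
def adjacency [∀ a b : V, Fintype (a ⟶ b)] : Matrix V V ℂ :=
  Matrix.of fun a b => (Fintype.card (a ⟶ b) : ℂ)

/-- The number of loops of a finite quiver. -/
def loopCount [∀ a b : V, Fintype (a ⟶ b)] : ℕ := ∑ a : V, Fintype.card (a ⟶ a)

end

/-! ### Jordan forms -/

/-- The Jordan block of size `s` with eigenvalue `μ` (ones below the diagonal). -/
def jordanBlock (s : ℕ) (μ : ℂ) : Matrix (Fin s) (Fin s) ℂ :=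
  Matrix.of fun i j => if i = j then μ else if (i : ℕ) = j + 1 then 1 else 0

/-- The Jordan form of the square complex matrix `M` consists of the Jordan blocks of size `s i`
with eigenvalue `μ i`: in a suitable basis, the endomorphism given by `M` has the block diagonal
matrix with these blocks. -/
def HasJordanForm {V ι : Type*} [Fintype V] [DecidableEq V] [Fintype ι] [DecidableEq ι]
    (M : Matrix V V ℂ) (s : ι → ℕ) (μ : ι → ℂ) : Prop :=
  ∃ b : Module.Basis (Σ i, Fin (s i)) ℂ (V → ℂ),
    LinearMap.toMatrix b b (Matrix.toLin' M) =
      Matrix.blockDiagonal' fun i => jordanBlock (s i) (μ i)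

end QuiverAlgebra

end

/-! Since J² = 0 in A, the kernel of a minimal projective cover is killed by the radical. Every
syzygy is therefore semisimple, and its support contains no source, because no arrow ends there. So
Ω̄ maps K₀ into the span of the classes [S_a], on which it acts by T, the transpose of the adjacency
matrix (`exists_omegaBar_eq_simpleClass`, `omegaBar_simpleClass`). Among these classes the only
relations are [S_a] = 0 for a sink, where S_a is projective; the functionals `multiplicity` show
that the others are independent. The problem becomes how late T can kill an integer vector, modulo
sinks.

Suppose Ω̄^m z ≠ 0 = Ω̄^(m+1) z with m ≥ n - 1, and let c be the vector of Ω̄z. Then T^(m-1) c is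
nonzero at some nonsink u and T^m c lives on sinks, so T^(m+1) c = 0. A walk contributing to T^(m-1)
c at u starts outside the sources and ends outside the sinks, so it extends at both ends to length m
+ 1 ≥ n. Thus T is not nilpotent and has an eigenvector with nonzero eigenvalue. The nilpotent chain
of c and this eigenvector are independent in dimension n, which forces m = n - 1 and makes them a
Jordan basis. All these vectors vanish at a source, so there is none. A sink would put its unit
vector in ker T, the line of T^(m-1) c, which is nonzero at the nonsink u. This is
`jordan_of_long_chain`; it also gives φdim(A) ≤ n.

Conversely, the trace identifies λ with the number of loops, so the identities T^(n-1)(T - λ) = 0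
and T^(n-2)(T - λ) ≠ 0 hold over ℤ and produce an integral chain c = (T - λ)x. Without sources each
S_b is the syzygy of some e_aA/αA, so one module M realizes c as a first syzygy; without sinks
nothing is lost in K₀. The extra step gives φ(M) ≥ n. Finally, the member is empty exactly when
there are neither sources nor sinks (`member_eq_empty_iff`). -/

noncomputable section

namespace QuiverAlgebra

open IgusaTodorov

/-! ### Instance shortcuts for the algebra and its opposite -/

section Shortcuts

variable {K : Type w} [Field K] {V : Type u} [Quiver.{v + 1} V] [Fintype V]

scoped instance : Ring (RadSqZero K V) := inferInstance
scoped instance : Semiring (RadSqZero K V) := inferInstance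
scoped instance : AddCommMonoid (RadSqZero K V) := inferInstance
scoped instance : AddCommGroup (RadSqZero K V) := inferInstance
scoped instance : Mul (RadSqZero K V) := inferInstance
scoped instance : Add (RadSqZero K V) := inferInstance
scoped instance : Algebra K (RadSqZero K V) := inferInstance
scoped instance : Module K (RadSqZero K V) := inferInstance
scoped instance : Ring (RadSqZero K V)ᵐᵒᵖ := inferInstance
scoped instance : Semiring (RadSqZero K V)ᵐᵒᵖ := inferInstance
scoped instance : MonoidWithZero (RadSqZero K V)ᵐᵒᵖ := inferInstance
scoped instance : Monoid (RadSqZero K V)ᵐᵒᵖ := inferInstance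
scoped instance : Module (RadSqZero K V)ᵐᵒᵖ (RadSqZero K V) := inferInstance
scoped instance : SMul (RadSqZero K V)ᵐᵒᵖ (RadSqZero K V) := inferInstance

end Shortcuts

/-! ### Coordinates on the radical square zero algebra -/

section Coordinates

variable {K : Type w} [Field K] {V : Type u} [Quiver.{v + 1} V]

open scoped Classical in
/-- The coefficient of a path in an element of the path algebra. -/
def pathCoeff (p : Σ a b : V, Quiver.Path a b) : PathAlgebra K V →ₗ[K] K :=
  Finsupp.lapply p

open scoped Classical in
theorem pathCoeff_ofPath (p : Σ a b : V, Quiver.Path a b) {a b : V} (q : Quiver.Path a b) :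
    pathCoeff p (ofPath q : PathAlgebra K V) = if (⟨a, b, q⟩ : Σ a b : V, Quiver.Path a b) = p
      then 1 else 0 := by
  change (Finsupp.single _ (1 : K)) p = _
  rw [Finsupp.single_apply]

/-- The trivial path at `a`. -/
abbrev nilPath (a : V) : Σ a b : V, Quiver.Path a b := ⟨a, a, Quiver.Path.nil⟩

/-- The path consisting of one arrow. -/
abbrev arrowPath {a b : V} (α : a ⟶ b) : Σ a b : V, Quiver.Path a b := ⟨a, b, α.toPath⟩

open scoped Classical in
theorem pathCoeff_nilPath_ofPath (c : V) {a b : V} (q : Quiver.Path a b) :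
    pathCoeff (nilPath c) (ofPath q : PathAlgebra K V) = if a = c ∧ q.length = 0
      then 1 else 0 := by
  rw [pathCoeff_ofPath]
  congr 1
  cases q with
  | nil =>
    simp only [Quiver.Path.length_nil, and_true, eq_iff_iff]
    constructor
    · intro h; injection h
    · rintro rfl; rfl
  | cons q α =>
    simp only [Quiver.Path.length_cons, Nat.add_eq_zero_iff, one_ne_zero, and_false, eq_iff_iff,
      iff_false]
    intro h
    have := congrArg (fun p : Σ a b : V, Quiver.Path a b => p.2.2.length) h
    simp at this

theorem pathCoeff_of_length_ne (p : Σ a b : V, Quiver.Path a b) {a b : V} (q : Quiver.Path a b)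
    (h : q.length ≠ p.2.2.length) : pathCoeff p (ofPath q : PathAlgebra K V) = 0 := by
  classical
  rw [pathCoeff_ofPath, if_neg]
  rintro rfl
  exact h rfl

theorem pathCoeff_of_source_ne (p : Σ a b : V, Quiver.Path a b) {a b : V} (q : Quiver.Path a b)
    (h : a ≠ p.1) : pathCoeff p (ofPath q : PathAlgebra K V) = 0 := by
  classical
  rw [pathCoeff_ofPath, if_neg]
  rintro rfl
  exact h rfl

theorem pathCoeff_of_target_ne (p : Σ a b : V, Quiver.Path a b) {a b : V} (q : Quiver.Path a b)
    (h : b ≠ p.2.1) : pathCoeff p (ofPath q : PathAlgebra K V) = 0 := by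
  classical
  rw [pathCoeff_ofPath, if_neg]
  rintro rfl
  exact h rfl

variable [Fintype V]

theorem bilinear_induction {motive : PathAlgebra K V → PathAlgebra K V → Prop}
    (x y : PathAlgebra K V)
    (zero_left : ∀ y, motive 0 y) (zero_right : ∀ x, motive x 0)
    (add_left : ∀ x x' y, motive x y → motive x' y → motive (x + x') y)
    (add_right : ∀ x y y', motive x y → motive x y' → motive x (y + y'))
    (smul_left : ∀ (c : K) (x y), motive x y → motive (c • x) y)
    (smul_right : ∀ (c : K) (x y), motive x y → motive x (c • y))
    (path : ∀ (a b c d : V) (p : Quiver.Path a b) (q : Quiver.Path c d),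
      motive (ofPath p) (ofPath q)) : motive x y := by
  induction x using induction_ofPath with
  | zero => exact zero_left y
  | add x x' hx hx' => exact add_left _ _ _ hx hx'
  | smul c x hx => exact smul_left _ _ _ hx
  | path a b p =>
    induction y using induction_ofPath with
    | zero => exact zero_right _
    | add x x' hx hx' => exact add_right _ _ _ hx hx'
    | smul c x hx => exact smul_right _ _ _ hx
    | path c d q => exact path _ _ _ _ _ _

/-- The trivial path at `v` factors only as itself times itself, so its coefficient is a character
of the path algebra. -/
theorem pathCoeff_nilPath_mul (v : V) (x y : PathAlgebra K V) :
    pathCoeff (nilPath v) (x * y) = pathCoeff (nilPath v) x * pathCoeff (nilPath v) y := by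
  classical
  induction x, y using bilinear_induction with
  | zero_left y => simp
  | zero_right x => simp
  | add_left x x' y h h' => simp [add_mul, h, h']
  | add_right x y y' h h' => simp [mul_add, h, h']
  | smul_left c x y h => simp [h, mul_assoc]
  | smul_right c x y h => simp [h]; ring
  | path a b c d p q =>
    by_cases hbc : b = c
    · subst hbc
      rw [ofPath_mul_ofPath]
      simp only [pathCoeff_nilPath_ofPath, Quiver.Path.length_comp]
      by_cases hp : p.length = 0
      · obtain rfl := p.eq_of_length_zero hp
        by_cases ha : a = v <;> simp [hp, ha]
      · simp [hp]
    · rw [ofPath_mul_ofPath_of_ne _ _ hbc]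
      simp only [pathCoeff_nilPath_ofPath, map_zero]
      by_cases hp : p.length = 0
      · obtain rfl := p.eq_of_length_zero hp
        by_cases ha : a = v
        · subst ha; simp [Ne.symm hbc]
        · simp [ha]
      · simp [hp]

/-- An arrow factors in exactly two ways, e_s α and α e_t, which yields this Leibniz rule. All later
computations in KQ/J² rest on it. -/
theorem pathCoeff_arrowPath_mul {s t : V} (α : s ⟶ t) (x y : PathAlgebra K V) :
    pathCoeff (arrowPath α) (x * y) = pathCoeff (nilPath s) x * pathCoeff (arrowPath α) y +
      pathCoeff (arrowPath α) x * pathCoeff (nilPath t) y := by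
  classical
  induction x, y using bilinear_induction with
  | zero_left y => simp
  | zero_right x => simp
  | add_left x x' y h h' => simp [add_mul, h, h']; ring
  | add_right x y y' h h' => simp [mul_add, h, h']; ring
  | smul_left c x y h => simp [h]; ring
  | smul_right c x y h => simp [h]; ring
  | path a b c d p q =>
    cases p with
    | nil =>
      rw [pathCoeff_of_length_ne (arrowPath α) (Quiver.Path.nil : Quiver.Path a a) (by simp),
        pathCoeff_nilPath_ofPath]
      by_cases hbc : a = c
      · subst hbc
        rw [ofPath_mul_ofPath, Quiver.Path.nil_comp]
        by_cases ha : a = s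
        · simp [ha]
        · simp [ha, pathCoeff_of_source_ne (arrowPath α) q ha]
      · rw [ofPath_mul_ofPath_of_ne _ _ hbc]
        by_cases ha : c = s
        · subst ha; simp [hbc]
        · simp [pathCoeff_of_source_ne (arrowPath α) q ha]
    | cons p β =>
      rw [pathCoeff_of_length_ne (nilPath s) _ (by simp)]
      cases q with
      | nil =>
        rw [pathCoeff_of_length_ne (arrowPath α) (Quiver.Path.nil : Quiver.Path c c) (by simp),
          pathCoeff_nilPath_ofPath]
        by_cases hbc : b = c
        · subst hbc
          rw [ofPath_mul_ofPath, Quiver.Path.comp_nil]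
          by_cases ha : b = t
          · simp [ha]
          · simp [ha, pathCoeff_of_target_ne (arrowPath α) (p.cons β) ha]
        · rw [ofPath_mul_ofPath_of_ne _ _ hbc]
          by_cases ha : b = t
          · subst ha; simp [Ne.symm hbc]
          · simp [pathCoeff_of_target_ne (arrowPath α) (p.cons β) ha]
      | cons q γ =>
        rw [pathCoeff_of_length_ne (nilPath t) _ (by simp)]
        by_cases hbc : b = c
        · subst hbc
          rw [ofPath_mul_ofPath, pathCoeff_of_length_ne _ _ (by simp)]
          simp
        · rw [ofPath_mul_ofPath_of_ne _ _ hbc]; simp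

theorem pathCoeff_nilPath_one (v : V) : pathCoeff (nilPath v) (1 : PathAlgebra K V) = 1 := by
  classical
  simp [one_def, pathCoeff_nilPath_ofPath]

/-- The coefficient is a ring homomorphism to K that kills every arrow, so its kernel contains the
ideal they generate. -/
theorem pathCoeff_nilPath_of_mem_arrowIdeal (v : V) {x : PathAlgebra K V}
    (hx : x ∈ arrowIdeal K V) : pathCoeff (nilPath v) x = 0 := by
  let f : PathAlgebra K V →+* K :=
    { toFun := pathCoeff (nilPath v)
      map_one' := pathCoeff_nilPath_one v
      map_mul' := pathCoeff_nilPath_mul v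
      map_zero' := map_zero _
      map_add' := map_add _ }
  have h : TwoSidedIdeal.span {x : PathAlgebra K V | ∃ (a b : V) (α : a ⟶ b),
      x = ofPath α.toPath} ≤ TwoSidedIdeal.ker f := by
    rw [TwoSidedIdeal.span_le]
    rintro _ ⟨a, b, α, rfl⟩
    exact (TwoSidedIdeal.mem_ker f).2 (pathCoeff_of_length_ne _ _ (by simp))
  exact (TwoSidedIdeal.mem_ker f).1 (h (TwoSidedIdeal.mem_asIdeal.1 hx))

theorem pathCoeff_arrowPath_of_mem {s t : V} (α : s ⟶ t) {x : PathAlgebra K V}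
    (hx : x ∈ arrowIdeal K V * arrowIdeal K V) : pathCoeff (arrowPath α) x = 0 := by
  induction hx using Submodule.mul_induction_on' with
  | mem_mul_mem x hx y hy =>
    rw [pathCoeff_arrowPath_mul, pathCoeff_nilPath_of_mem_arrowIdeal _ hx,
      pathCoeff_nilPath_of_mem_arrowIdeal _ hy]
    simp
  | add x _ y _ hx hy => rw [map_add, hx, hy, add_zero]

/-- The coefficient of `e_a` in an element of `K Q / J²`. -/
def vertexCoeff (a : V) : RadSqZero K V →+* K :=
  Ideal.Quotient.lift _
    { toFun := pathCoeff (nilPath a)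
      map_one' := pathCoeff_nilPath_one a
      map_mul' := pathCoeff_nilPath_mul a
      map_zero' := map_zero _
      map_add' := map_add _ }
    fun _ hx => pathCoeff_nilPath_of_mem_arrowIdeal a (Ideal.mul_le_right hx)

/-- The coefficient of an arrow in an element of `K Q / J²`. -/
def arrowCoeff {s t : V} (α : s ⟶ t) : RadSqZero K V →+ K :=
  QuotientAddGroup.lift _ (pathCoeff (arrowPath α)).toAddMonoidHom
    fun _ hx => pathCoeff_arrowPath_of_mem α hx

/-- An arrow as an element of `K Q / J²`. -/
def arrow {s t : V} (α : s ⟶ t) : RadSqZero K V :=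
  Ideal.Quotient.mk _ (ofPath α.toPath)

theorem vertexCoeff_mk (a : V) (x : PathAlgebra K V) :
    vertexCoeff a (Ideal.Quotient.mk _ x) = pathCoeff (nilPath a) x := rfl

open scoped Classical in
theorem vertexCoeff_idem (a b : V) :
    vertexCoeff a (idem K b) = if b = a then 1 else 0 := by
  rw [idem, vertexCoeff_mk, pathCoeff_nilPath_ofPath]; simp

@[simp]
theorem vertexCoeff_idem_self (a : V) : vertexCoeff a (idem K a) = 1 := by
  rw [vertexCoeff_idem, if_pos rfl]

theorem vertexCoeff_idem_of_ne {a b : V} (h : b ≠ a) : vertexCoeff a (idem K b) = 0 := by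
  rw [vertexCoeff_idem, if_neg h]

@[simp]
theorem vertexCoeff_arrow (a : V) {s t : V} (α : s ⟶ t) :
    vertexCoeff a (arrow α : RadSqZero K V) = 0 :=
  pathCoeff_of_length_ne _ _ (by simp)

@[simp]
theorem vertexCoeff_algebraMap (a : V) (c : K) :
    vertexCoeff a (algebraMap K (RadSqZero K V) c) = c := by
  change pathCoeff (nilPath a) (algebraMap K (PathAlgebra K V) c) = c
  rw [Algebra.algebraMap_eq_smul_one, map_smul, pathCoeff_nilPath_one, smul_eq_mul, mul_one]

@[simp]
theorem arrowCoeff_idem {s t : V} (α : s ⟶ t) (a : V) : arrowCoeff α (idem K a) = 0 :=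
  pathCoeff_of_length_ne _ _ (by simp)

@[simp]
theorem arrowCoeff_arrow_self {s t : V} (α : s ⟶ t) :
    arrowCoeff α (arrow α : RadSqZero K V) = 1 := by
  classical
  exact (pathCoeff_ofPath _ _).trans (if_pos rfl)

theorem arrowCoeff_arrow_of_ne {s t s' t' : V} (α : s ⟶ t) (β : s' ⟶ t')
    (h : (⟨s, t, α⟩ : Σ a b : V, (a ⟶ b)) ≠ ⟨s', t', β⟩) :
    arrowCoeff α (arrow β : RadSqZero K V) = 0 := by
  classical
  refine (pathCoeff_ofPath _ _).trans (if_neg fun h' => h ?_)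
  obtain ⟨rfl, h'⟩ := Sigma.mk.inj_iff.1 h'
  obtain ⟨rfl, h'⟩ := Sigma.mk.inj_iff.1 h'.eq
  have := h'.eq
  injection this with _ _ _ h3
  rw [h3]

@[simp]
theorem arrowCoeff_algebraMap {s t : V} (α : s ⟶ t) (c : K) :
    arrowCoeff α (algebraMap K (RadSqZero K V) c) = 0 := by
  change pathCoeff (arrowPath α) (algebraMap K (PathAlgebra K V) c) = 0
  rw [Algebra.algebraMap_eq_smul_one, map_smul, one_def, map_sum, Finset.sum_eq_zero, smul_zero]
  exact fun a _ => pathCoeff_of_length_ne _ _ (by simp)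

theorem arrowCoeff_mul {s t : V} (α : s ⟶ t) (x y : RadSqZero K V) :
    arrowCoeff α (x * y) = vertexCoeff s x * arrowCoeff α y + arrowCoeff α x * vertexCoeff t y := by
  obtain ⟨x, rfl⟩ := Ideal.Quotient.mk_surjective x
  obtain ⟨y, rfl⟩ := Ideal.Quotient.mk_surjective y
  exact pathCoeff_arrowPath_mul α x y

theorem vertexCoeff_smul (a : V) (c : K) (x : RadSqZero K V) :
    vertexCoeff a (c • x) = c * vertexCoeff a x := by
  rw [Algebra.smul_def, map_mul, vertexCoeff_algebraMap]

theorem arrowCoeff_smul {s t : V} (α : s ⟶ t) (c : K) (x : RadSqZero K V) :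
    arrowCoeff α (c • x) = c * arrowCoeff α x := by
  rw [Algebra.smul_def, arrowCoeff_mul, vertexCoeff_algebraMap, arrowCoeff_algebraMap, zero_mul,
    add_zero]

@[simp]
theorem idem_mul_idem_self (a : V) : (idem K a * idem K a : RadSqZero K V) = idem K a := by
  rw [idem, ← map_mul, ofPath_mul_ofPath, Quiver.Path.comp_nil]

theorem idem_mul_idem_of_ne {a b : V} (h : a ≠ b) :
    (idem K a * idem K b : RadSqZero K V) = 0 := by
  rw [idem, idem, ← map_mul, ofPath_mul_ofPath_of_ne _ _ h, map_zero]

@[simp]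
theorem idem_mul_arrow {s t : V} (α : s ⟶ t) :
    (idem K s * arrow α : RadSqZero K V) = arrow α := by
  rw [idem, arrow, ← map_mul, ofPath_mul_ofPath, Quiver.Path.nil_comp]

@[simp]
theorem arrow_mul_idem {s t : V} (α : s ⟶ t) :
    (arrow α * idem K t : RadSqZero K V) = arrow α := by
  rw [idem, arrow, ← map_mul, ofPath_mul_ofPath, Quiver.Path.comp_nil]

theorem sum_idem : ∑ a : V, idem K a = (1 : RadSqZero K V) := by
  simp only [idem]
  rw [← map_sum, ← one_def, map_one]

/-- The elements of the radical of `K Q / J²`, described by their coordinates. -/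
def IsRad (x : RadSqZero K V) : Prop := ∀ a : V, vertexCoeff a x = 0

theorem IsRad.mul_left {x : RadSqZero K V} (hx : IsRad x) (y : RadSqZero K V) : IsRad (y * x) :=
  fun a => by rw [map_mul, hx a, mul_zero]

theorem IsRad.mul_right {x : RadSqZero K V} (hx : IsRad x) (y : RadSqZero K V) : IsRad (x * y) :=
  fun a => by rw [map_mul, hx a, zero_mul]

theorem isRad_arrow {s t : V} (α : s ⟶ t) : IsRad (arrow α : RadSqZero K V) :=
  fun a => vertexCoeff_arrow a α

variable [∀ a b : V, Fintype (a ⟶ b)]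

/-- Paths of length at least two lie in J², so the trivial paths and the arrows span; the
coefficient maps are dual to them. -/
theorem eq_sum_coeff (x : RadSqZero K V) :
    x = ∑ a : V, vertexCoeff a x • idem K a +
      ∑ α : (Σ a b : V, (a ⟶ b)), arrowCoeff α.2.2 x • arrow α.2.2 := by
  classical
  obtain ⟨x, rfl⟩ := Ideal.Quotient.mk_surjective x
  induction x using induction_ofPath with
  | zero => simp
  | add x y hx hy =>
    rw [map_add]
    simp only [map_add, add_smul, Finset.sum_add_distrib]
    conv_lhs => rw [hx, hy]
    abel
  | smul c x hx =>
    have h : (Ideal.Quotient.mk (arrowIdeal K V * arrowIdeal K V)) (c • x) =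
      c • (Ideal.Quotient.mk (arrowIdeal K V * arrowIdeal K V)) x := rfl
    rw [h]
    simp only [vertexCoeff_smul, arrowCoeff_smul, mul_smul, ← Finset.smul_sum, ← smul_add]
    rw [← hx]
  | path a b p =>
    cases p with
    | nil =>
      change idem K a = ∑ c : V, vertexCoeff c (idem K a) • idem K c +
        ∑ α : (Σ a b : V, (a ⟶ b)), arrowCoeff α.2.2 (idem K a) • arrow α.2.2
      simp [vertexCoeff_idem]
    | cons p α =>
      cases p with
      | nil =>
        change arrow α = ∑ c : V, vertexCoeff c (arrow α) • idem K c +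
          ∑ β : (Σ a b : V, (a ⟶ b)), arrowCoeff β.2.2 (arrow α) • arrow β.2.2
        rw [Finset.sum_eq_single (⟨a, b, α⟩ : Σ a b : V, (a ⟶ b))]
        · simp
        · intro β _ hβ
          rw [arrowCoeff_arrow_of_ne _ _ hβ, zero_smul]
        · simp
      | cons p β =>
        have h : (ofPath ((p.cons β).cons α) : PathAlgebra K V)
            = (ofPath p * ofPath β.toPath) * ofPath α.toPath := by
          rw [ofPath_mul_ofPath, ofPath_mul_ofPath]; rfl
        have h' : (ofPath ((p.cons β).cons α) : PathAlgebra K V) ∈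
            (arrowIdeal K V * arrowIdeal K V) := by
          rw [h]
          exact Ideal.mul_mem_mul
            ((arrowIdeal K V).mul_mem_left _ (ofPath_toPath_mem_arrowIdeal K β))
            (ofPath_toPath_mem_arrowIdeal K α)
        rw [Ideal.Quotient.eq_zero_iff_mem.2 h']
        simp

theorem IsRad.eq_sum {x : RadSqZero K V} (hx : IsRad x) :
    x = ∑ α : (Σ a b : V, (a ⟶ b)), arrowCoeff α.2.2 x • arrow α.2.2 := by
  conv_lhs => rw [eq_sum_coeff x]
  rw [Finset.sum_eq_zero fun a _ => by rw [hx a, zero_smul], zero_add]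

theorem ext_coeff {x y : RadSqZero K V} (h : ∀ a, vertexCoeff a x = vertexCoeff a y)
    (h' : ∀ (s t : V) (α : s ⟶ t), arrowCoeff α x = arrowCoeff α y) : x = y := by
  rw [eq_sum_coeff x, eq_sum_coeff y]
  simp only [h, h']

theorem IsRad.mul_eq_zero {x y : RadSqZero K V} (hx : IsRad x) (hy : IsRad y) : x * y = 0 :=
  ext_coeff (fun a => by simp [hx a]) fun s t α => by simp [arrowCoeff_mul, hx s, hy t]

/-- A vertex without outgoing arrows. -/
def IsSink (a : V) : Prop := ∀ b : V, IsEmpty (a ⟶ b)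

/-- A vertex without incoming arrows. -/
def IsSource (a : V) : Prop := ∀ b : V, IsEmpty (b ⟶ a)

/-- No arrow ends at a source, so the left ideal A e_a is the line K e_a. -/
theorem mul_idem_of_isSource {a : V} (ha : IsSource a) (x : RadSqZero K V) :
    x * idem K a = vertexCoeff a x • idem K a := by
  classical
  refine ext_coeff (fun b => ?_) fun s t α => ?_
  · rw [map_mul, vertexCoeff_smul]
    by_cases h : a = b
    · rw [h]
    · rw [vertexCoeff_idem_of_ne h, mul_zero, mul_zero]
  · rw [arrowCoeff_mul, arrowCoeff_smul, arrowCoeff_idem, mul_zero, mul_zero, zero_add]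
    have h : a ≠ t := by rintro rfl; exact (ha s).false α
    rw [vertexCoeff_idem_of_ne h, mul_zero]

theorem idem_mul_of_isSink {a : V} (ha : IsSink a) (x : RadSqZero K V) :
    idem K a * x = vertexCoeff a x • idem K a := by
  classical
  refine ext_coeff (fun b => ?_) fun s t α => ?_
  · rw [map_mul, vertexCoeff_smul, mul_comm]
    by_cases h : a = b
    · rw [h]
    · rw [vertexCoeff_idem_of_ne h, mul_zero, mul_zero]
  · rw [arrowCoeff_mul, arrowCoeff_smul, arrowCoeff_idem, mul_zero, zero_mul, add_zero]
    have h : a ≠ s := by rintro rfl; exact (ha t).false α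
    rw [vertexCoeff_idem_of_ne h, zero_mul]

/-- Multiplication of a radical element depends only on the vertex coefficients. -/
theorem IsRad.mul_eq_sum {j : RadSqZero K V} (hj : IsRad j) (x : RadSqZero K V) :
    j * x = ∑ a : V, vertexCoeff a x • (j * idem K a) := by
  conv_lhs => rw [eq_sum_coeff x, mul_add]
  rw [Finset.mul_sum, Finset.mul_sum, Finset.sum_eq_zero (s := Finset.univ (α := Σ a b : V, (a ⟶ b))),
    add_zero]
  · simp
  · intro α _
    rw [mul_smul_comm, hj.mul_eq_zero (isRad_arrow _), smul_zero]

theorem isRad_iff_mem_radSubmodule (x : RadSqZero K V) : IsRad x ↔ x ∈ radSubmodule K V := by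
  constructor
  · intro hx
    rw [hx.eq_sum]
    refine Submodule.sum_mem _ fun α _ => ?_
    refine ⟨arrowCoeff α.2.2 x • ofPath α.2.2.toPath, ?_, rfl⟩
    rw [Algebra.smul_def]
    exact Ideal.mul_mem_left _ _ (ofPath_toPath_mem_arrowIdeal K α.2.2)
  · rintro ⟨y, hy, rfl⟩ a
    exact pathCoeff_nilPath_of_mem_arrowIdeal a hy

end Coordinates

open MulOpposite (op unop)

/-! ### Right modules over the radical square zero algebra -/

section Modules

variable {K : Type w} [Field K] {V : Type u} [Quiver.{v + 1} V] [Fintype V]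

section Action

variable {M : Type*} [AddCommGroup M] [Module (RadSqZero K V)ᵐᵒᵖ M]

/-- An element `m` of a right module with `m e_a = m`. -/
def IsHomog (a : V) (m : M) : Prop := op (idem K a) • m = m

/-- An element of a right module which is annihilated by the radical. -/
def InSocle (m : M) : Prop := ∀ j : RadSqZero K V, IsRad j → op j • m = 0

theorem op_smul_op_smul (x y : RadSqZero K V) (m : M) : op x • op y • m = op (y * x) • m := by
  rw [smul_smul]; rfl

theorem isHomog_op_idem_smul (a : V) (m : M) : IsHomog (K := K) a (op (idem K a) • m) := by
  rw [IsHomog, op_smul_op_smul, idem_mul_idem_self]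

theorem sum_op_idem_smul (m : M) : ∑ a : V, op (idem K a) • m = m := by
  rw [← Finset.sum_smul, show ∑ a : V, op (idem K a) = op (∑ a : V, idem K a) from
    (map_sum (MulOpposite.opAddEquiv : RadSqZero K V ≃+ (RadSqZero K V)ᵐᵒᵖ) _ _).symm, sum_idem,
    MulOpposite.op_one, one_smul]

theorem IsHomog.op_idem_smul_of_ne {a b : V} (h : a ≠ b) {m : M} (hm : IsHomog (K := K) a m) :
    op (idem K b) • m = 0 := by
  rw [← hm, op_smul_op_smul, idem_mul_idem_of_ne h, MulOpposite.op_zero, zero_smul]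

theorem InSocle.op_smul {m : M} (hm : InSocle (K := K) (V := V) m) (x : RadSqZero K V) :
    InSocle (K := K) (V := V) (op x • m) := fun j hj => by
  rw [op_smul_op_smul]; exact hm _ (hj.mul_left x)

/-- Right multiplication of an element of a right module by scalars. -/
theorem op_smul_op_algebraMap_smul (x : RadSqZero K V) (c : K) (m : M) :
    op x • op (algebraMap K (RadSqZero K V) c) • m =
      op (algebraMap K (RadSqZero K V) c) • op x • m := by
  rw [op_smul_op_smul, op_smul_op_smul, Algebra.commutes]

theorem op_algebraMap_smul_eq_zero {c : K} (hc : c ≠ 0) {m : M}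
    (h : op (algebraMap K (RadSqZero K V) c) • m = 0) : m = 0 := by
  have : op (algebraMap K (RadSqZero K V) c⁻¹) • op (algebraMap K (RadSqZero K V) c) • m = 0 := by
    rw [h, smul_zero]
  rwa [op_smul_op_smul, ← map_mul, mul_inv_cancel₀ hc, map_one, MulOpposite.op_one, one_smul]
    at this

theorem op_kSmul_smul (c : K) (x : RadSqZero K V) (m : M) :
    op (c • x) • m = op (algebraMap K (RadSqZero K V) c) • op x • m := by
  rw [op_smul_op_smul, Algebra.smul_def, Algebra.commutes]

/-- The difference between e_a x and its e_a-part is radical, hence kills `m`. Thus a nonzero `m` of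
this kind spans a copy of the simple module at `a`. -/
theorem InSocle.op_smul_of_isHomog {a : V} {m : M} (hm : InSocle (K := K) (V := V) m)
    (ha : IsHomog (K := K) a m) (x : RadSqZero K V) :
    op x • m = op (algebraMap K (RadSqZero K V) (vertexCoeff a x)) • m := by
  have h : IsRad (idem K a * x - vertexCoeff a x • idem K a) := fun b => by
    rw [map_sub, map_mul, vertexCoeff_smul]
    by_cases hab : a = b
    · subst hab; simp
    · rw [vertexCoeff_idem_of_ne hab]; simp
  have h1 := hm _ h
  rw [MulOpposite.op_sub, sub_smul, sub_eq_zero, op_kSmul_smul, ← op_smul_op_smul, ha] at h1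
  exact h1

end Action

/-! ### Simple modules -/

/-- The simple right module at the vertex `a`. -/
def Simple (K : Type w) [Field K] {V : Type u} (_ : V) : Type (max w u (v + 1)) :=
  ULift.{max u (v + 1)} K

/-- An element of a simple module given by a scalar. -/
def Simple.mk {V : Type u} (a : V) (c : K) : Simple.{u, v} K a := ULift.up c

/-- The scalar corresponding to an element of a simple module. -/
def Simple.val {V : Type u} {a : V} (s : Simple.{u, v} K a) : K := ULift.down s

theorem Simple.ext {V : Type u} {a : V} {s t : Simple.{u, v} K a} (h : s.val = t.val) : s = t :=
  ULift.ext _ _ h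

instance {V : Type u} (a : V) : AddCommGroup (Simple.{u, v} K a) :=
  inferInstanceAs (AddCommGroup (ULift.{max u (v + 1)} K))

@[simp]
theorem Simple.val_mk {V : Type u} (a : V) (c : K) : (Simple.mk.{u, v} a c).val = c := rfl

theorem Simple.val_add {V : Type u} {a : V} (s t : Simple.{u, v} K a) :
    (s + t).val = s.val + t.val := rfl

@[simp]
theorem Simple.val_zero {V : Type u} (a : V) : (0 : Simple.{u, v} K a).val = 0 := rfl

/-- The character of `(K Q / J²)ᵐᵒᵖ` given by the coefficient of `e_a`. -/
def vertexCharacter (a : V) : (RadSqZero K V)ᵐᵒᵖ →+* K :=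
  (vertexCoeff a).fromOpposite fun _ _ => Commute.all _ _

instance (a : V) : Module (RadSqZero K V)ᵐᵒᵖ (Simple.{u, v} K a) :=
  Module.compHom (ULift.{max u (v + 1)} K) (vertexCharacter a)

theorem Simple.val_op_smul {a : V} (x : RadSqZero K V) (s : Simple.{u, v} K a) :
    (op x • s).val = vertexCoeff a x * s.val := rfl

instance (a : V) : Module.Finite (RadSqZero K V)ᵐᵒᵖ (Simple.{u, v} K a) :=
  Module.Finite.of_surjective
    (LinearMap.toSpanSingleton (RadSqZero K V)ᵐᵒᵖ (Simple.{u, v} K a) (Simple.mk a 1))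
    (fun s => ⟨op (algebraMap K _ s.val), Simple.ext (by
      rw [LinearMap.toSpanSingleton_apply, Simple.val_op_smul, vertexCoeff_algebraMap,
        Simple.val_mk, mul_one])⟩)

variable (K) in
/-- The simple right module at the vertex `a`, as an object of the category of finitely generated
modules. -/
def simpleObj (a : V) : FGModuleCat (RadSqZero K V)ᵐᵒᵖ :=
  FGModuleCat.of _ (Simple.{u, v} K a)

/-- The map from a simple module given by a homogeneous element of the socle. -/
def simpleHom {M : Type*} [AddCommGroup M] [Module (RadSqZero K V)ᵐᵒᵖ M] {a : V} {m : M}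
    (hm : InSocle (K := K) (V := V) m) (ha : IsHomog (K := K) a m) :
    Simple.{u, v} K a →ₗ[(RadSqZero K V)ᵐᵒᵖ] M where
  toFun s := op (algebraMap K (RadSqZero K V) s.val) • m
  map_add' s t := by
    rw [Simple.val_add, map_add, MulOpposite.op_add, add_smul]
  map_smul' r s := by
    change op (algebraMap K _ (vertexCoeff a (unop r) * s.val)) • m =
      op (unop r) • op (algebraMap K _ s.val) • m
    rw [op_smul_op_algebraMap_smul, hm.op_smul_of_isHomog ha (unop r),
      op_smul_op_smul, ← map_mul]

/-! ### Classes of direct sums -/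

theorem cls_pi {R : Type u} [Ring R] (k : ℕ) (X : Fin k → FGModuleCat.{u} R) (N : FGModuleCat.{u} R)
    (e : N ≃ₗ[R] (Π i, X i)) : cls N = ∑ i, cls (X i) := by
  induction k generalizing N with
  | zero =>
    rw [Finset.univ_eq_empty, Finset.sum_empty]
    apply cls_projective
    have : Subsingleton N := e.toEquiv.subsingleton
    infer_instance
  | succ k ih =>
    rw [Fin.sum_univ_succ, ← ih (fun i => X i.succ) (FGModuleCat.of R (Π i : Fin k, X i.succ))
      (LinearEquiv.refl R _)]
    exact cls_prod (e.trans (Fin.consLinearEquiv R fun i => X i).symm)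

/-- A module annihilated by the radical, with a homogeneous basis, is a direct sum of simples. -/
theorem cls_eq_sum_of_basis {N : FGModuleCat (RadSqZero K V)ᵐᵒᵖ} {k : ℕ} (a : Fin k → V)
    (m : Fin k → N) (hs : ∀ i, InSocle (K := K) (V := V) (m i))
    (hm : ∀ i, IsHomog (K := K) (a i) (m i))
    (hspan : Submodule.span (RadSqZero K V)ᵐᵒᵖ (Set.range m) = ⊤)
    (hind : ∀ c : Fin k → K, ∑ i, op (algebraMap K (RadSqZero K V) (c i)) • m i = 0 → c = 0) :
    cls N = ∑ i, cls (simpleObj K (a i)) := by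
  classical
  let f : (Π i, Simple.{u, v} K (a i)) →ₗ[(RadSqZero K V)ᵐᵒᵖ] N :=
    LinearMap.lsum _ _ ℕ fun i => simpleHom (hs i) (hm i)
  have hf : ∀ s, f s = ∑ i, op (algebraMap K (RadSqZero K V) (s i).val) • m i := fun s => by
    simp [f, simpleHom]
  have hinj : Function.Injective f := by
    rw [← LinearMap.ker_eq_bot, LinearMap.ker_eq_bot']
    intro s h
    rw [hf] at h
    funext i
    exact Simple.ext (congrFun (hind (fun i => (s i).val) h) i)
  have hsurj : Function.Surjective f := by
    rw [← LinearMap.range_eq_top, eq_top_iff, ← hspan, Submodule.span_le]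
    rintro _ ⟨i, rfl⟩
    refine ⟨Pi.single i (Simple.mk _ 1), ?_⟩
    rw [LinearMap.lsum_piSingle]
    change op (algebraMap K (RadSqZero K V) 1) • m i = m i
    rw [map_one, MulOpposite.op_one, one_smul]
  exact cls_pi k (fun i => simpleObj K (a i)) N (LinearEquiv.ofBijective f ⟨hinj, hsurj⟩).symm

/-! ### Homogeneous generators and projective covers -/

/-- The indecomposable projective right module `e_a A`. -/
def proj (K : Type w) [Field K] (a : V) : Submodule (RadSqZero K V)ᵐᵒᵖ (RadSqZero K V) where
  carrier := {x | idem K a * x = x}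
  zero_mem' := mul_zero _
  add_mem' {x y} hx hy := by
    change _ * _ = _
    rw [mul_add, hx, hy]
  smul_mem' r x hx := by
    change _ * (x * unop r) = x * unop r
    rw [← mul_assoc, hx]

theorem mem_proj {a : V} {x : RadSqZero K V} : x ∈ proj K a ↔ idem K a * x = x := Iff.rfl

theorem vertexCoeff_of_mem_proj {a b : V} (h : a ≠ b) {x : RadSqZero K V} (hx : x ∈ proj K a) :
    vertexCoeff b x = 0 := by
  rw [← mem_proj.1 hx, map_mul, vertexCoeff_idem_of_ne h, zero_mul]

theorem isRad_of_mem_proj {a : V} {x : RadSqZero K V} (hx : x ∈ proj K a)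
    (h : vertexCoeff a x = 0) : IsRad x := fun b => by
  by_cases hab : a = b
  · rw [← hab, h]
  · exact vertexCoeff_of_mem_proj hab hx

/-- Left multiplication by `e_a`. -/
def toProj (a : V) : RadSqZero K V →ₗ[(RadSqZero K V)ᵐᵒᵖ] proj K a where
  toFun x := ⟨idem K a * x, by rw [mem_proj, ← mul_assoc, idem_mul_idem_self]⟩
  map_add' x y := Subtype.ext (mul_add _ _ _)
  map_smul' r x := Subtype.ext (mul_assoc _ _ _).symm

theorem toProj_surjective (a : V) : Function.Surjective (toProj (K := K) a) :=
  fun x => ⟨x, Subtype.ext x.2⟩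

/-- The right regular module. -/
def opSelfEquiv : (RadSqZero K V)ᵐᵒᵖ ≃ₗ[(RadSqZero K V)ᵐᵒᵖ] RadSqZero K V where
  toFun := unop
  invFun := op
  map_add' _ _ := rfl
  map_smul' _ _ := rfl
  left_inv _ := rfl
  right_inv _ := rfl

instance finite_self : Module.Finite (RadSqZero K V)ᵐᵒᵖ (RadSqZero K V) :=
  Module.Finite.equiv opSelfEquiv

instance projective_self : Module.Projective (RadSqZero K V)ᵐᵒᵖ (RadSqZero K V) :=
  Module.Projective.of_equiv opSelfEquiv

instance (a : V) : Module.Projective (RadSqZero K V)ᵐᵒᵖ (proj K a) :=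
  Module.Projective.of_split (proj K a).subtype (toProj a)
    (LinearMap.ext fun x => Subtype.ext x.2)

instance (a : V) : Module.Finite (RadSqZero K V)ᵐᵒᵖ (proj K a) :=
  Module.Finite.of_surjective (toProj a) (toProj_surjective a)

instance (k : ℕ) (a : Fin k → V) :
    Module.Projective (RadSqZero K V)ᵐᵒᵖ (Π i, proj K (a i)) :=
  Module.Projective.of_equiv DFinsupp.linearEquivFunOnFintype

theorem idem_mem_proj (a : V) : idem K a ∈ proj K a := idem_mul_idem_self a

theorem eq_sum_op_smul_single {k : ℕ} {a : Fin k → V} (x : Π i, proj K (a i)) :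
    x = ∑ i, op (x i : RadSqZero K V) •
      (Pi.single i ⟨idem K (a i), idem_mem_proj _⟩ : Π i, proj K (a i)) := by
  funext i
  rw [Finset.sum_apply, Finset.sum_eq_single i]
  · rw [Pi.smul_apply, Pi.single_eq_same]
    exact Subtype.ext (x i).2.symm
  · intro j _ hj
    rw [Pi.smul_apply, Pi.single_eq_of_ne (Ne.symm hj), smul_zero]
  · simp

section Generators

variable {M : Type*} [AddCommGroup M] [Module (RadSqZero K V)ᵐᵒᵖ M]

theorem exists_homog_generators [Module.Finite (RadSqZero K V)ᵐᵒᵖ M] :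
    ∃ (k : ℕ) (a : Fin k → V) (m : Fin k → M), (∀ i, IsHomog (K := K) (a i) (m i)) ∧
      Submodule.span (RadSqZero K V)ᵐᵒᵖ (Set.range m) = ⊤ := by
  obtain ⟨n, s, hs⟩ := Module.Finite.exists_fin (R := (RadSqZero K V)ᵐᵒᵖ) (M := M)
  let e := Fintype.equivFin (Fin n × V)
  refine ⟨_, fun i => (e.symm i).2, fun i => op (idem K (e.symm i).2) • s (e.symm i).1,
    fun i => isHomog_op_idem_smul _ _, ?_⟩
  rw [eq_top_iff, ← hs, Submodule.span_le]
  rintro _ ⟨j, rfl⟩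
  rw [SetLike.mem_coe, ← sum_op_idem_smul (K := K) (V := V) (s j)]
  exact Submodule.sum_mem _ fun a _ => Submodule.subset_span ⟨e (j, a), by simp⟩

/-- Evaluation of right multiplication at an element. -/
def evalHom (m : M) : RadSqZero K V →ₗ[(RadSqZero K V)ᵐᵒᵖ] M where
  toFun x := op x • m
  map_add' x y := by rw [MulOpposite.op_add, add_smul]
  map_smul' r x := smul_assoc r (op x) m

/-- The map from a sum of indecomposable projectives given by a family of elements. -/
def coverHom {k : ℕ} (a : Fin k → V) (m : Fin k → M) :
    (Π i, proj K (a i)) →ₗ[(RadSqZero K V)ᵐᵒᵖ] M :=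
  ∑ i, evalHom (m i) ∘ₗ (proj K (a i)).subtype ∘ₗ LinearMap.proj i

theorem coverHom_apply {k : ℕ} (a : Fin k → V) (m : Fin k → M) (x : Π i, proj K (a i)) :
    coverHom a m x = ∑ i, op (x i : RadSqZero K V) • m i := by
  simp [coverHom, evalHom]

theorem coverHom_surjective {k : ℕ} {a : Fin k → V} {m : Fin k → M}
    (hm : ∀ i, IsHomog (K := K) (a i) (m i))
    (hspan : Submodule.span (RadSqZero K V)ᵐᵒᵖ (Set.range m) = ⊤) :
    Function.Surjective (coverHom (K := K) a m) := by
  classical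
  rw [← LinearMap.range_eq_top, eq_top_iff, ← hspan, Submodule.span_le]
  rintro _ ⟨i, rfl⟩
  refine ⟨Pi.single i ⟨idem K (a i), idem_mem_proj _⟩, ?_⟩
  rw [coverHom_apply, Finset.sum_eq_single i]
  · rw [Pi.single_eq_same]; exact hm i
  · intro j _ hj
    rw [Pi.single_eq_of_ne hj, ZeroMemClass.coe_zero, MulOpposite.op_zero, zero_smul]
  · simp

variable [∀ a b : V, Fintype (a ⟶ b)]

/-- In the local ring e A e write exe = ce + j with j² = 0, and multiply by ce - j to get c²e. For c
≠ 0 this inverts exe up to a scalar. -/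
theorem exists_mul_eq_smul_idem (a : V) (x : RadSqZero K V) :
    ∃ u, idem K a * x * idem K a * u = (vertexCoeff a x * vertexCoeff a x) • idem K a := by
  set e := idem K a with he
  set c := vertexCoeff a x with hc
  obtain ⟨j, hj⟩ : ∃ j, j = e * x * e - c • e := ⟨_, rfl⟩
  have hjrad : IsRad j := fun b => by
    rw [hj, map_sub, map_mul, map_mul, vertexCoeff_smul]
    by_cases hab : a = b
    · rw [← hab]; simp [he, hc]
    · rw [he, vertexCoeff_idem_of_ne hab]; simp
  have hej : e * j = j := by
    rw [hj, mul_sub, mul_smul_comm, he, idem_mul_idem_self, ← mul_assoc, ← mul_assoc,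
      idem_mul_idem_self]
  have hje : j * e = j := by
    rw [hj, sub_mul, smul_mul_assoc, he, mul_assoc, idem_mul_idem_self]
  refine ⟨c • e - j, ?_⟩
  have : e * x * e = c • e + j := by rw [hj]; abel
  rw [this, add_mul, mul_sub, mul_sub, smul_mul_smul_comm, hjrad.mul_eq_zero hjrad,
    smul_mul_assoc, hej, mul_smul_comm, hje, he, idem_mul_idem_self]
  abel

/-- A minimal system of homogeneous generators. -/
theorem exists_minimal_homog_generators [Module.Finite (RadSqZero K V)ᵐᵒᵖ M] :
    ∃ (k : ℕ) (a : Fin k → V) (m : Fin k → M), (∀ i, IsHomog (K := K) (a i) (m i)) ∧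
      Submodule.span (RadSqZero K V)ᵐᵒᵖ (Set.range m) = ⊤ ∧
      ∀ x : Fin k → RadSqZero K V, ∑ i, op (x i) • m i = 0 → ∀ i, vertexCoeff (a i) (x i) = 0 := by
  classical
  have H := exists_homog_generators (K := K) (V := V) (M := M)
  obtain ⟨a, m, hm, hspan⟩ := Nat.find_spec H
  refine ⟨Nat.find H, a, m, hm, hspan, fun x hx i => ?_⟩
  -- A relation whose `i`-th coefficient is not radical at `a i` allows solving for `m i`, so this
  -- generator could be dropped from a family of minimal size.
  by_contra hc
  have hmin := fun k' (h : k' < Nat.find H) => Nat.find_min H h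
  generalize Nat.find H = k at *
  cases k with
  | zero => exact i.elim0
  | succ k =>
  refine hmin k k.lt_succ_self ⟨fun j => a (i.succAbove j), fun j => m (i.succAbove j),
    fun j => hm _, ?_⟩
  set N := Submodule.span (RadSqZero K V)ᵐᵒᵖ (Set.range fun j => m (i.succAbove j)) with hN
  have hmem : ∀ j, m (i.succAbove j) ∈ N := fun j => Submodule.subset_span ⟨j, rfl⟩
  suffices hi : m i ∈ N by
    rw [eq_top_iff, ← hspan, Submodule.span_le]
    rintro _ ⟨j, rfl⟩
    obtain rfl | ⟨j, rfl⟩ := i.eq_self_or_eq_succAbove j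
    · exact hi
    · exact hmem j
  rw [Fin.sum_univ_succAbove _ i] at hx
  have h1 : op (x i) • m i ∈ N := by
    rw [eq_neg_of_add_eq_zero_left hx]
    exact N.neg_mem (N.sum_mem fun j _ => N.smul_mem _ (hmem j))
  set c := vertexCoeff (a i) (x i) with hcdef
  obtain ⟨u, hu⟩ := exists_mul_eq_smul_idem (a i) (x i)
  have h3 : op (algebraMap K (RadSqZero K V) (c * c)) • m i ∈ N := by
    have h4 : op ((c * c) • idem K (a i)) • m i = op (idem K (a i) * u) • op (x i) • m i := by
      conv_rhs => rw [← hm i, op_smul_op_smul, op_smul_op_smul]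
      rw [← hu]
      simp only [mul_assoc]
    rw [op_kSmul_smul, hm i] at h4
    rw [h4]
    exact N.smul_mem _ h1
  have h6 : op (algebraMap K (RadSqZero K V) (c * c)⁻¹) • op (algebraMap K (RadSqZero K V) (c * c)) • m i
      = m i := by
    rw [op_smul_op_smul, ← map_mul, mul_inv_cancel₀ (mul_ne_zero hc hc), map_one,
      MulOpposite.op_one, one_smul]
  rw [← h6]
  exact N.smul_mem _ h3

end Generators

variable [∀ a b : V, Fintype (a ⟶ b)]

/-- A right module has a cover by a sum of indecomposable projectives whose kernel consists of
families of radical elements. -/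
theorem exists_cover_with_isRad_kernel (M : FGModuleCat (RadSqZero K V)ᵐᵒᵖ) :
    ∃ (k : ℕ) (a : Fin k → V) (π : (Π i, proj K (a i)) →ₗ[(RadSqZero K V)ᵐᵒᵖ] M),
      Function.Surjective π ∧ ∀ x, π x = 0 → ∀ i, IsRad (x i : RadSqZero K V) := by
  obtain ⟨k, a, m, hm, hspan, hmin⟩ := exists_minimal_homog_generators (K := K) (V := V) (M := M)
  refine ⟨k, a, coverHom a m, coverHom_surjective hm hspan, fun x hx i => ?_⟩
  rw [coverHom_apply] at hx
  exact isRad_of_mem_proj (x i).2 (hmin (fun i => x i) hx i)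

theorem inSocle_of_isRad {k : ℕ} {a : Fin k → V} {x : Π i, proj K (a i)}
    (hx : ∀ i, IsRad (x i : RadSqZero K V)) : InSocle (K := K) (V := V) x := fun j hj => by
  funext i
  exact Subtype.ext ((hx i).mul_eq_zero hj)

/-- Nakayama by hand: split each generator as y + z with y in `N` and z in `L`. A radical
coefficient kills z, so every element of `L`, having radical coordinates, already lies in `N`. -/
theorem superfluous_of_isRad {k : ℕ} {a : Fin k → V}
    {L N : Submodule (RadSqZero K V)ᵐᵒᵖ (Π i, proj K (a i))}
    (hL : ∀ x ∈ L, ∀ i, IsRad (x i : RadSqZero K V)) (h : N ⊔ L = ⊤) : N = ⊤ := by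
  classical
  rw [← h, eq_comm, sup_eq_left]
  intro x hx
  rw [eq_sum_op_smul_single x]
  refine N.sum_mem fun i _ => ?_
  have hi : (Pi.single i ⟨idem K (a i), idem_mem_proj _⟩ : Π i, proj K (a i)) ∈ N ⊔ L := by
    rw [h]; trivial
  obtain ⟨y, hy, z, hz, hyz⟩ := Submodule.mem_sup.1 hi
  rw [← hyz, smul_add, inSocle_of_isRad (hL z hz) _ (hL x hx i), add_zero]
  exact N.smul_mem _ hy

end Modules

/-! ### The action of the syzygy operator on the classes of the simple modules -/

section Syzygies

variable {K : Type w} [Field K] {V : Type u} [Quiver.{v + 1} V] [Fintype V]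

variable (K V) in
/-- The class `∑ c_a [S_a]` of a virtual semisimple module. -/
def simpleClass : (V → ℤ) →+ K0 (RadSqZero K V)ᵐᵒᵖ where
  toFun c := ∑ a, c a • cls (simpleObj K a)
  map_zero' := by simp
  map_add' c d := by simp [add_smul, Finset.sum_add_distrib]

theorem simpleClass_apply (c : V → ℤ) :
    simpleClass K V c = ∑ a, c a • cls (simpleObj K a) := rfl

/-- The cover of a simple module by an indecomposable projective. -/
def projToSimple (a : V) : proj K a →ₗ[(RadSqZero K V)ᵐᵒᵖ] Simple.{u, v} K a where
  toFun x := Simple.mk a (vertexCoeff a x.1)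
  map_add' x y := Simple.ext (map_add (vertexCoeff a) x.1 y.1)
  map_smul' r x := Simple.ext (by
    change vertexCoeff a (x.1 * unop r) = vertexCoeff a (unop r) * vertexCoeff a x.1
    rw [map_mul, mul_comm])

theorem projToSimple_surjective (a : V) : Function.Surjective (projToSimple (K := K) a) := by
  intro s
  refine ⟨⟨s.val • idem K a, ?_⟩, Simple.ext ?_⟩
  · rw [mem_proj, mul_smul_comm, idem_mul_idem_self]
  · change vertexCoeff a (s.val • idem K a) = s.val
    rw [vertexCoeff_smul, vertexCoeff_idem_self, mul_one]

theorem projToSimple_eq_zero {a : V} {x : proj K a} :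
    projToSimple a x = 0 ↔ vertexCoeff a x.1 = 0 :=
  ⟨fun h => congrArg Simple.val h, fun h => Simple.ext h⟩

theorem op_algebraMap_smul_eq (c : K) (x : RadSqZero K V) :
    op (algebraMap K (RadSqZero K V) c) • x = c • x := by
  rw [Algebra.smul_def, Algebra.commutes]; rfl

theorem arrow_mem_proj {a b : V} (α : a ⟶ b) : (arrow α : RadSqZero K V) ∈ proj K a :=
  idem_mul_arrow α

variable [∀ a b : V, Fintype (a ⟶ b)]

/-- By Schanuel's lemma any projective surjection computes Ω̄, so minimality never has to be checked
when working in K₀. -/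
theorem omegaBar_cls_eq_ker {M P : FGModuleCat (RadSqZero K V)ᵐᵒᵖ}
    (f : P →ₗ[(RadSqZero K V)ᵐᵒᵖ] M) (hP : Module.Projective (RadSqZero K V)ᵐᵒᵖ P)
    (hf : Function.Surjective f) : omegaBar (cls M) = cls (kerObj f) := by
  rw [← syzygyClass_eq f hP hf]
  simp [omegaBar, cls]

/-- A module annihilated by the radical is a sum of simple modules. -/
theorem exists_cls_eq_simpleClass (N : FGModuleCat (RadSqZero K V)ᵐᵒᵖ)
    (hN : ∀ m : N, InSocle (K := K) (V := V) m) :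
    ∃ c : V → ℤ, cls N = simpleClass K V c ∧
      ∀ a, (∀ m : N, op (idem K a) • m = 0) → c a = 0 := by
  classical
  obtain ⟨k, a, m, hm, hspan, hmin⟩ := exists_minimal_homog_generators (K := K) (V := V) (M := N)
  have hind : ∀ c : Fin k → K,
      ∑ i, op (algebraMap K (RadSqZero K V) (c i)) • m i = 0 → c = 0 := fun c hc =>
    funext fun i => by
      have := hmin _ hc i
      rwa [vertexCoeff_algebraMap] at this
  refine ⟨fun b => ∑ i, if a i = b then 1 else 0, ?_, fun b hb => ?_⟩
  · rw [cls_eq_sum_of_basis a m (fun i => hN _) hm hspan hind, simpleClass_apply]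
    simp only [Finset.sum_smul, ite_smul, one_smul, zero_smul]
    rw [Finset.sum_comm]
    simp
  · refine Finset.sum_eq_zero fun i _ => if_neg ?_
    rintro rfl
    have h0 : m i = 0 := by rw [← hm i]; exact hb _
    have h1 := congrFun (hind (Pi.single i 1) ?_) i
    · simp at h1
    · rw [Finset.sum_eq_single i]
      · rw [h0, smul_zero]
      · intro j _ hj
        rw [Pi.single_eq_of_ne hj, map_zero, MulOpposite.op_zero, zero_smul]
      · simp

/-- Syzygies are classes of semisimple modules without sources in the support. -/
theorem exists_omegaBar_eq_simpleClass (z : K0 (RadSqZero K V)ᵐᵒᵖ) :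
    ∃ c : V → ℤ, omegaBar z = simpleClass K V c ∧ ∀ a, IsSource a → c a = 0 := by
  obtain ⟨z, rfl⟩ := QuotientAddGroup.mk'_surjective _ z
  induction z using FreeAbelianGroup.induction_on with
  | zero => exact ⟨0, by simp, by simp⟩
  | of M =>
    obtain ⟨k, a, π, hπ, hker⟩ := exists_cover_with_isRad_kernel M
    let P : FGModuleCat (RadSqZero K V)ᵐᵒᵖ := FGModuleCat.of _ (Π i, proj K (a i))
    have h := omegaBar_cls_eq_ker (M := M) (P := P) π
      (inferInstanceAs (Module.Projective _ (Π i, proj K (a i)))) hπ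
    obtain ⟨c, hc, hc'⟩ := exists_cls_eq_simpleClass (kerObj (P := P) π) (fun x j hj =>
      Subtype.ext (inSocle_of_isRad (hker x.1 x.2) j hj))
    -- At a source `b`, right multiplication by e_b leaves only the coefficient of e_b, and this
    -- vanishes on radical elements.
    refine ⟨c, h.trans hc, fun b hb => hc' b fun x => Subtype.ext (funext fun i => Subtype.ext ?_)⟩
    change (x.1 i).1 * idem K b = 0
    rw [mul_idem_of_isSource hb, hker x.1 x.2 i b, zero_smul]
  | neg M h =>
    obtain ⟨c, hc, hc'⟩ := h
    exact ⟨-c, by rw [map_neg, map_neg, map_neg, hc], fun a ha => by simp [hc' a ha]⟩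
  | add x y hx hy =>
    obtain ⟨c, hc, hc'⟩ := hx
    obtain ⟨d, hd, hd'⟩ := hy
    exact ⟨c + d, by rw [map_add, map_add, map_add, hc, hd],
      fun a ha => by simp [hc' a ha, hd' a ha]⟩

/-- The kernel of e_a A → S_a has the arrows leaving `a` as a basis, and each arrow spans a copy of
the simple module at its target. -/
theorem omegaBar_cls_simpleObj (a : V) :
    omegaBar (cls (simpleObj K a)) =
      ∑ b, (Fintype.card (a ⟶ b)) • cls (simpleObj K b) := by
  classical
  let P : FGModuleCat (RadSqZero K V)ᵐᵒᵖ := FGModuleCat.of _ (proj K a)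
  have h := omegaBar_cls_eq_ker (M := simpleObj K a) (P := P) (projToSimple a)
    (inferInstanceAs (Module.Projective _ (proj K a))) (projToSimple_surjective a)
  rw [h]
  let e := Fintype.equivFin (Σ b : V, (a ⟶ b))
  let m : (Σ b : V, (a ⟶ b)) → kerObj (M := simpleObj K a) (P := P) (projToSimple a) :=
    fun α => ⟨⟨arrow α.2, arrow_mem_proj α.2⟩, projToSimple_eq_zero.2 (vertexCoeff_arrow _ _)⟩
  have hrad : ∀ x : kerObj (M := simpleObj K a) (P := P) (projToSimple a), IsRad x.1.1 :=
    fun x => isRad_of_mem_proj x.1.2 (projToSimple_eq_zero.1 x.2)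
  have hsum : ∀ c : (Σ b : V, (a ⟶ b)) → K,
      (∑ α, op (algebraMap K (RadSqZero K V) (c α)) • m α).1.1 = ∑ α, c α • arrow α.2 := by
    intro c
    let g : kerObj (M := simpleObj K a) (P := P) (projToSimple a) →ₗ[(RadSqZero K V)ᵐᵒᵖ]
      RadSqZero K V := (proj K a).subtype ∘ₗ (LinearMap.ker (projToSimple a)).subtype
    change g _ = _
    rw [map_sum]
    refine Finset.sum_congr rfl fun α _ => ?_
    rw [map_smul]
    exact op_algebraMap_smul_eq _ _
  rw [cls_eq_sum_of_basis (fun i => (e.symm i).1) (fun i => m (e.symm i))]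
  · rw [Equiv.sum_comp e.symm fun α : Σ b : V, (a ⟶ b) => cls (simpleObj K α.1),
      Fintype.sum_sigma]
    simp
  · exact fun i j hj => Subtype.ext (Subtype.ext ((hrad _).mul_eq_zero hj))
  · exact fun i => Subtype.ext (Subtype.ext (arrow_mul_idem _))
  · rw [eq_top_iff]
    intro x _
    have hx : x = ∑ α, op (algebraMap K (RadSqZero K V) (arrowCoeff α.2 x.1.1)) • m α := by
      refine Subtype.ext (Subtype.ext ?_)
      rw [hsum]
      conv_lhs => rw [(hrad x).eq_sum]
      rw [Fintype.sum_sigma, Finset.sum_eq_single a]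
      · intro s _ hs
        refine Finset.sum_eq_zero fun α _ => ?_
        rw [← mem_proj.1 x.1.2, arrowCoeff_mul, vertexCoeff_idem_of_ne (Ne.symm hs), zero_mul,
          arrowCoeff_idem, zero_mul, add_zero, zero_smul]
      · simp
    rw [hx]
    exact Submodule.sum_mem _ fun α _ => Submodule.smul_mem _ _
      (Submodule.subset_span ⟨e α, by simp⟩)
  · intro c hc
    rw [← Equiv.sum_comp e] at hc
    simp only [Equiv.symm_apply_apply] at hc
    have h2 := hsum fun α => c (e α)
    rw [hc] at h2
    funext i
    have h3 := congrArg (arrowCoeff (e.symm i).2) h2.symm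
    rw [map_sum, Finset.sum_eq_single (e.symm i)] at h3
    · rw [arrowCoeff_smul, arrowCoeff_arrow_self, mul_one, Equiv.apply_symm_apply] at h3
      exact h3.trans (map_zero _)
    · intro β _ hβ
      rw [arrowCoeff_smul, arrowCoeff_arrow_of_ne, mul_zero]
      intro h
      apply hβ
      obtain ⟨-, h⟩ := Sigma.mk.inj_iff.1 h
      exact h.eq.symm
    · simp

/-- The action of the syzygy operator on multiplicities of simple modules. -/
def arrowAction (V : Type u) [Quiver.{v + 1} V] [Fintype V] [∀ a b : V, Fintype (a ⟶ b)] :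
    Matrix V V ℤ := Matrix.of fun b a => (Fintype.card (a ⟶ b) : ℤ)

theorem omegaBar_simpleClass (c : V → ℤ) :
    omegaBar (simpleClass K V c) = simpleClass K V ((arrowAction V).mulVec c) := by
  rw [simpleClass_apply, simpleClass_apply, map_sum]
  simp only [map_zsmul, omegaBar_cls_simpleObj, Finset.smul_sum, Matrix.mulVec, dotProduct,
    Finset.sum_smul, arrowAction, Matrix.of_apply]
  rw [Finset.sum_comm]
  refine Finset.sum_congr rfl fun b _ => Finset.sum_congr rfl fun a _ => ?_
  rw [← natCast_zsmul, smul_smul, mul_comm]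

theorem omegaBar_iterate_simpleClass [DecidableEq V] (k : ℕ) (c : V → ℤ) :
    (omegaBar (R := (RadSqZero K V)ᵐᵒᵖ))^[k] (simpleClass K V c) =
      simpleClass K V ((arrowAction V ^ k).mulVec c) := by
  induction k with
  | zero => simp
  | succ k ih =>
    rw [Function.iterate_succ_apply', ih, omegaBar_simpleClass, pow_succ', Matrix.mulVec_mulVec]

/-! ### Independence of the classes of the nonprojective simple modules -/

/-- No arrow leaves a sink, so e_a A = K e_a and the simple module is its own projective cover. -/
theorem cls_simpleObj_of_isSink {a : V} (ha : IsSink a) : cls (simpleObj K a) = 0 := by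
  apply cls_projective
  have hinj : Function.Injective (projToSimple (K := K) a) := by
    rw [← LinearMap.ker_eq_bot, LinearMap.ker_eq_bot']
    intro x hx
    refine Subtype.ext ?_
    rw [← mem_proj.1 x.2, idem_mul_of_isSink ha, projToSimple_eq_zero.1 hx, zero_smul]
    rfl
  exact Module.Projective.of_equiv
    (LinearEquiv.ofBijective (projToSimple a) ⟨hinj, projToSimple_surjective a⟩)

theorem simpleClass_eq_zero_of_isSink {c : V → ℤ} (hc : ∀ a, ¬ IsSink a → c a = 0) :
    simpleClass K V c = 0 := by
  refine Finset.sum_eq_zero fun a _ => ?_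
  by_cases ha : IsSink a
  · rw [cls_simpleObj_of_isSink ha, smul_zero]
  · rw [hc a ha, zero_smul]

end Syzygies

/-! ### Lengths of functorial submodules -/

section Preradical

variable {R : Type u} [Ring R]

/-- The additivity of the length of a functorial submodule. -/
theorem length_functorial_submodule (S : ∀ M : FGModuleCat.{u} R, Submodule R M)
    (hS : ∀ (M N : FGModuleCat.{u} R) (f : M →ₗ[R] N), ∀ m ∈ S M, f m ∈ S N)
    {M M' M'' : FGModuleCat.{u} R} (e : M ≃ₗ[R] (M' × M'')) :
    Module.length R (S M) = Module.length R (S M') + Module.length R (S M'') := by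
  let g : S M ≃ₗ[R] S M' × S M'' :=
    { toFun := fun x => (⟨(e x.1).1, hS M M' (LinearMap.fst R M' M'' ∘ₗ e.toLinearMap) _ x.2⟩,
        ⟨(e x.1).2, hS M M'' (LinearMap.snd R M' M'' ∘ₗ e.toLinearMap) _ x.2⟩)
      map_add' := fun x y => by ext <;> simp
      map_smul' := fun r x => by ext <;> simp
      invFun := fun y => ⟨e.symm (y.1.1, 0) + e.symm (0, y.2.1), (S M).add_mem
        (hS M' M (e.symm.toLinearMap ∘ₗ LinearMap.inl R M' M'') _ y.1.2)
        (hS M'' M (e.symm.toLinearMap ∘ₗ LinearMap.inr R M' M'') _ y.2.2)⟩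
      left_inv := fun x => by
        ext
        simp only [← map_add, Prod.mk_add_mk, add_zero, zero_add]
        exact e.symm_apply_apply _
      right_inv := fun y => by
        ext <;> simp }
  rw [g.length_eq, Module.length_prod]

end Preradical

/-! ### Independence of the simple classes at nonsinks -/

section Independence

variable {K : Type w} [Field K] {V : Type u} [Quiver.{v + 1} V] [Fintype V]

/-- The homogeneous elements of the socle at a vertex. -/
def socleAt (a : V) (M : Type*) [AddCommGroup M] [Module (RadSqZero K V)ᵐᵒᵖ M] :
    Submodule (RadSqZero K V)ᵐᵒᵖ M where
  carrier := {m | IsHomog (K := K) a m ∧ InSocle (K := K) (V := V) m}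
  zero_mem' := ⟨smul_zero _, fun _ _ => smul_zero _⟩
  add_mem' {x y} hx hy := ⟨by rw [IsHomog, smul_add, hx.1, hy.1], fun j hj => by
    rw [smul_add, hx.2 j hj, hy.2 j hj, add_zero]⟩
  smul_mem' r x hx := by
    refine ⟨?_, hx.2.op_smul (unop r)⟩
    change op (idem K a) • op (unop r) • x = op (unop r) • x
    rw [hx.2.op_smul_of_isHomog hx.1, op_smul_op_algebraMap_smul, hx.1]

/-- The radical of a right module. -/
def radOf (M : Type*) [AddCommGroup M] [Module (RadSqZero K V)ᵐᵒᵖ M] :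
    Submodule (RadSqZero K V)ᵐᵒᵖ M :=
  Submodule.span _ {m | ∃ (j : RadSqZero K V) (n : M), IsRad j ∧ m = op j • n}

section Maps

variable {M N : Type*} [AddCommGroup M] [Module (RadSqZero K V)ᵐᵒᵖ M] [AddCommGroup N]
  [Module (RadSqZero K V)ᵐᵒᵖ N] (f : M →ₗ[(RadSqZero K V)ᵐᵒᵖ] N)

theorem map_mem_socleAt {a : V} {m : M} (hm : m ∈ socleAt (K := K) a M) :
    f m ∈ socleAt (K := K) a N :=
  ⟨by rw [IsHomog, ← map_smul, hm.1], fun j hj => by rw [← map_smul, hm.2 j hj, map_zero]⟩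

theorem map_mem_radOf {m : M} (hm : m ∈ radOf (K := K) (V := V) M) :
    f m ∈ radOf (K := K) (V := V) N := by
  refine Submodule.span_induction (p := fun m _ => f m ∈ radOf (K := K) (V := V) N) ?_ ?_ ?_ ?_ hm
  · rintro _ ⟨j, n, hj, rfl⟩
    rw [map_smul]
    exact Submodule.subset_span ⟨j, _, hj, rfl⟩
  · rw [map_zero]; exact Submodule.zero_mem _
  · intro x y _ _ hx hy
    rw [map_add]; exact Submodule.add_mem _ hx hy
  · intro r x _ hx
    rw [map_smul]; exact Submodule.smul_mem _ _ hx

end Maps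

instance (a : V) : Nontrivial (Simple.{u, v} K a) :=
  ⟨Simple.mk a 0, Simple.mk a 1, fun h => zero_ne_one (congrArg Simple.val h)⟩

theorem radOf_simple (a : V) : radOf (K := K) (V := V) (Simple.{u, v} K a) = ⊥ := by
  rw [radOf, Submodule.span_eq_bot]
  rintro _ ⟨j, s, hj, rfl⟩
  exact Simple.ext (by rw [Simple.val_op_smul, hj a, zero_mul, Simple.val_zero])

theorem socleAt_simple_self (a : V) : socleAt (K := K) a (Simple.{u, v} K a) = ⊤ := by
  rw [eq_top_iff]
  intro s _
  refine ⟨Simple.ext ?_, fun j hj => Simple.ext ?_⟩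
  · rw [Simple.val_op_smul, vertexCoeff_idem_self, one_mul]
  · rw [Simple.val_op_smul, hj a, zero_mul, Simple.val_zero]

theorem socleAt_simple_of_ne {a b : V} (h : a ≠ b) :
    socleAt (K := K) a (Simple.{u, v} K b) = ⊥ := by
  rw [eq_bot_iff]
  intro s hs
  refine Simple.ext ?_
  rw [← hs.1, Simple.val_op_smul, vertexCoeff_idem_of_ne h, zero_mul, Simple.val_zero]

variable [∀ a b : V, Fintype (a ⟶ b)]

scoped instance isArtinianRing_op : IsArtinianRing (RadSqZero K V)ᵐᵒᵖ :=
  IsArtinianRing.of_finite K (RadSqZero K V)ᵐᵒᵖ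

/-- Embed `P` as a summand of a sum of modules e_b A. If y = y e_a is killed by an arrow α leaving
`a`, the coefficient of α in yα is that of e_a in y, so y is radical. This makes `multiplicity`
vanish on projectives. -/
theorem socleAt_le_radOf_of_projective {a : V} (ha : ¬ IsSink a)
    (P : FGModuleCat (RadSqZero K V)ᵐᵒᵖ) (hP : Module.Projective (RadSqZero K V)ᵐᵒᵖ P) :
    socleAt (K := K) a P ≤ radOf (K := K) (V := V) P := by
  classical
  intro x hx
  obtain ⟨k, b, π, hπ, -⟩ := exists_cover_with_isRad_kernel P
  obtain ⟨s, hs⟩ := Module.projective_lifting_property π LinearMap.id hπ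
  have hxs : π (s x) = x := LinearMap.congr_fun hs x
  rw [← hxs]
  apply map_mem_radOf
  set y := s x with hy
  have hya : y ∈ socleAt (K := K) a _ := map_mem_socleAt s hx
  have hrad : ∀ i, IsRad (y i).1 := by
    intro i c
    have h1 : (y i).1 * idem K a = (y i).1 := congrArg Subtype.val (congrFun hya.1 i)
    by_cases hac : a = c
    · subst hac
      obtain ⟨d, hd⟩ := not_forall.1 ha
      obtain ⟨α⟩ := not_isEmpty_iff.1 hd
      have h2 : (y i).1 * arrow α = 0 :=
        congrArg Subtype.val (congrFun (hya.2 _ (isRad_arrow α)) i)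
      have h3 := congrArg (arrowCoeff α) h2
      rwa [arrowCoeff_mul, arrowCoeff_arrow_self, vertexCoeff_arrow, mul_one, mul_zero, add_zero,
        map_zero] at h3
    · rw [← h1, map_mul, vertexCoeff_idem_of_ne hac, mul_zero]
  rw [eq_sum_op_smul_single y]
  exact Submodule.sum_mem _ fun i _ => Submodule.subset_span ⟨_, _, hrad i, rfl⟩

/-- Lengths are finite under these chain conditions, so additivity survives the passage to natural
numbers, where ⊤ would become 0. -/
theorem length_toNat_add {R : Type u} [Ring R] [IsArtinianRing R] [IsNoetherianRing R]
    (S : ∀ M : FGModuleCat.{u} R, Submodule R M)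
    (hS : ∀ (M N : FGModuleCat.{u} R) (f : M →ₗ[R] N), ∀ m ∈ S M, f m ∈ S N)
    {M M' M'' : FGModuleCat.{u} R} (e : M ≃ₗ[R] (M' × M'')) :
    ((Module.length R (S M)).toNat : ℤ) =
      (Module.length R (S M')).toNat + (Module.length R (S M'')).toNat := by
  rw [length_functorial_submodule S hS e, ENat.toNat_add]
  · push_cast; rfl
  · exact Module.length_ne_top
  · exact Module.length_ne_top

/-- The multiplicity of a nonprojective simple module as a direct summand, as a function on `K₀`. -/
def multiplicity {a : V} (ha : ¬ IsSink a) : K0 (RadSqZero K V)ᵐᵒᵖ →+ ℤ :=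
  QuotientAddGroup.lift _ (FreeAbelianGroup.lift fun M : FGModuleCat (RadSqZero K V)ᵐᵒᵖ =>
    ((Module.length (RadSqZero K V)ᵐᵒᵖ (socleAt (K := K) a M)).toNat : ℤ) -
      (Module.length (RadSqZero K V)ᵐᵒᵖ
        (socleAt (K := K) a M ⊓ radOf (K := K) (V := V) M : Submodule _ M)).toNat) (by
    rw [AddSubgroup.closure_le]
    rintro x (⟨M, M', M'', ⟨e⟩, rfl⟩ | ⟨P, hP, rfl⟩)
    -- Both the homogeneous socle and its intersection with the radical are functorial, so each
    -- length is additive on direct sums.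
    · have h1 := length_toNat_add (fun M => socleAt (K := K) a M)
        (fun M N f m hm => map_mem_socleAt f hm) e
      have h2 := length_toNat_add
        (fun M => socleAt (K := K) a M ⊓ radOf (K := K) (V := V) M)
        (fun M N f m hm => ⟨map_mem_socleAt f hm.1, map_mem_radOf f hm.2⟩) e
      simp only [SetLike.mem_coe, AddMonoidHom.mem_ker, map_sub, FreeAbelianGroup.lift_apply_of]
      rw [h1, h2]
      ring
    · simp only [SetLike.mem_coe, AddMonoidHom.mem_ker, FreeAbelianGroup.lift_apply_of]
      rw [inf_eq_left.2 (socleAt_le_radOf_of_projective ha P hP), sub_self])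

theorem multiplicity_cls {a : V} (ha : ¬ IsSink a) (M : FGModuleCat (RadSqZero K V)ᵐᵒᵖ) :
    multiplicity ha (cls M) =
    ((Module.length (RadSqZero K V)ᵐᵒᵖ (socleAt (K := K) a M)).toNat : ℤ) -
      (Module.length (RadSqZero K V)ᵐᵒᵖ
        (socleAt (K := K) a M ⊓ radOf (K := K) (V := V) M : Submodule _ M)).toNat := by
  simp [multiplicity, cls]

theorem multiplicity_simpleObj_self {a : V} (ha : ¬ IsSink a) :
    multiplicity ha (cls (simpleObj K a)) ≠ 0 := by
  have h1 : socleAt (K := K) a (simpleObj K a) = ⊤ := socleAt_simple_self a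
  have h2 : radOf (K := K) (V := V) (simpleObj K a) = ⊥ := radOf_simple a
  rw [multiplicity_cls, h1, h2, inf_bot_eq, Module.length_bot, Module.length_top]
  have h3 : Module.length (RadSqZero K V)ᵐᵒᵖ (simpleObj K a) ≠ 0 := by
    rw [Ne, Module.length_eq_zero_iff, not_subsingleton_iff_nontrivial]
    exact inferInstanceAs (Nontrivial (Simple.{u, v} K a))
  have h4 : Module.length (RadSqZero K V)ᵐᵒᵖ (simpleObj K a) ≠ ⊤ := Module.length_ne_top
  simp [h3, h4]

theorem multiplicity_simpleObj_of_ne {a b : V} (ha : ¬ IsSink a) (h : a ≠ b) :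
    multiplicity ha (cls (simpleObj K b)) = 0 := by
  have h1 : socleAt (K := K) a (simpleObj K b) = ⊥ := socleAt_simple_of_ne h
  rw [multiplicity_cls, h1, bot_inf_eq, sub_self]

/-- The functional `multiplicity` at `a` is nonzero on the simple class at `a` and zero on all other
simple classes. -/
theorem eq_zero_of_simpleClass_eq_zero {c : V → ℤ} (hc : simpleClass K V c = 0) {a : V}
    (ha : ¬ IsSink a) : c a = 0 := by
  have h := congrArg (multiplicity ha) hc
  rw [map_zero, simpleClass_apply, map_sum, Finset.sum_eq_single a] at h
  · rw [map_zsmul, smul_eq_mul] at h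
    exact (mul_eq_zero.1 h).resolve_right (multiplicity_simpleObj_self ha)
  · intro b _ hb
    rw [map_zsmul, multiplicity_simpleObj_of_ne ha (Ne.symm hb), smul_zero]
  · simp

end Independence

end QuiverAlgebra

/-! ### Bounds for the Igusa-Todorov function -/

namespace IgusaTodorov

variable {R : Type u} [Ring R] [IsNoetherianRing R]

theorem le_phi {M : FGModuleCat.{u} R} {x : K0 R} (hx : x ∈ addSpan M) {k : ℕ}
    (h : (omegaBar (R := R))^[k] x ≠ 0) (h' : (omegaBar (R := R))^[k + 1] x = 0) :
    ((k + 1 : ℕ) : ℕ∞) ≤ phi M := by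
  refine le_iInf₂ fun l hl => ?_
  rw [Nat.cast_le]
  by_contra! hlt
  -- The shift s = k - l turns the defining condition into injectivity on the image of Ω̄^k,
  -- contradicted by Ω̄^k x and 0.
  have hs := hl (k - l)
  rw [Nat.add_sub_cancel' (Nat.lt_succ_iff.1 hlt)] at hs
  refine h (hs ⟨x, hx, rfl⟩ ⟨0, (addSpan M).zero_mem, iterate_map_zero omegaBar k⟩ ?_)
  rw [map_zero]
  exact (Function.iterate_succ_apply' _ _ _).symm.trans h'

/-- Injectivity on a subgroup is a statement about differences. The kernel condition ranges over all
of K₀, so the bound is uniform in `M`. -/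
theorem phi_le {l : ℕ} (h : ∀ (z : K0 R) (m : ℕ), l ≤ m → (omegaBar (R := R))^[m + 1] z = 0 →
    (omegaBar (R := R))^[m] z = 0) (M : FGModuleCat.{u} R) : phi M ≤ l := by
  refine iInf₂_le l fun s => ?_
  rintro _ ⟨x, -, rfl⟩ _ ⟨y, -, rfl⟩ hxy
  rw [← sub_eq_zero, ← iterate_map_sub]
  refine h _ _ (Nat.le_add_right l s) ?_
  rw [iterate_map_sub, Function.iterate_succ_apply', Function.iterate_succ_apply', hxy, sub_self]

/-- A module splits as the direct sum of a retract and the kernel of the retraction. -/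
def prodKerEquiv {M X : Type*} [AddCommGroup M] [AddCommGroup X] [Module R M] [Module R X]
    (s : X →ₗ[R] M) (p : M →ₗ[R] X) (h : ∀ x, p (s x) = x) : M ≃ₗ[R] X × LinearMap.ker p where
  toFun m := (p m, ⟨m - s (p m), by rw [LinearMap.mem_ker, map_sub, h, sub_self]⟩)
  invFun y := s y.1 + y.2.1
  map_add' x y := by ext <;> simp; abel
  map_smul' r x := by ext <;> simp [smul_sub]
  left_inv x := by simp
  right_inv y := by
    have h2 : p y.2.1 = 0 := y.2.2
    ext <;> simp [h, h2]

theorem cls_mem_addSpan_pi {V : Type*} [Finite V] [DecidableEq V] (X : V → FGModuleCat.{u} R)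
    (M : FGModuleCat.{u} R) (e : M ≃ₗ[R] (Π b, X b)) {b : V} (hb : IsIndecomposable (X b)) :
    cls (X b) ∈ addSpan M := by
  let p : M →ₗ[R] X b := LinearMap.proj b ∘ₗ e.toLinearMap
  refine AddSubgroup.subset_closure ⟨X b, kerObj p, hb,
    ⟨prodKerEquiv (e.symm.toLinearMap ∘ₗ LinearMap.single R (fun b => X b) b) p fun x => ?_⟩, rfl⟩
  simp [p]

end IgusaTodorov

namespace QuiverAlgebra

open IgusaTodorov

open MulOpposite (op unop)

/-! ### Simple modules as syzygies of quotients by an arrow -/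

section Uniserial

variable {K : Type w} [Field K] {V : Type u} [Quiver.{v + 1} V] [Fintype V]

/-- The submodule of `e_a A` generated by an arrow. -/
def arrowSpan (K : Type w) [Field K] {a b : V} (α : a ⟶ b) :
    Submodule (RadSqZero K V)ᵐᵒᵖ (proj K a) :=
  Submodule.span _ {⟨arrow α, arrow_mem_proj α⟩}

theorem isRad_of_mem_arrowSpan {a b : V} {α : a ⟶ b} {x : proj K a} (hx : x ∈ arrowSpan K α) :
    IsRad x.1 := by
  obtain ⟨r, rfl⟩ := Submodule.mem_span_singleton.1 hx
  exact (isRad_arrow α).mul_right (unop r)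

variable [∀ a b : V, Fintype (a ⟶ b)]

/-- This is locality of e_a A e_a. Choose `r` taking the generator to its first component. If the
e_a-coefficient of `r` is zero, e r e squares to zero yet fixes that component, which must vanish.
Otherwise e r e is invertible and kills the second component. -/
theorem isIndecomposable_of_homog_generator {M : FGModuleCat (RadSqZero K V)ᵐᵒᵖ} [Nontrivial M]
    {a : V} {g : M} (hg : IsHomog (K := K) a g)
    (hspan : Submodule.span (RadSqZero K V)ᵐᵒᵖ {g} = ⊤) : IsIndecomposable M := by
  refine ⟨inferInstance, fun X Y ⟨e⟩ => ?_⟩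
  have hgen : ∀ m : M, ∃ r : RadSqZero K V, op r • g = m := fun m => by
    obtain ⟨r, hr⟩ := Submodule.mem_span_singleton.1 (hspan ▸ Submodule.mem_top : m ∈ _)
    exact ⟨unop r, hr⟩
  obtain ⟨r, hr⟩ := hgen (e.symm ((e g).1, 0))
  have he := congrArg e hr
  rw [map_smul, LinearEquiv.apply_symm_apply] at he
  have hy : op r • (e g).1 = (e g).1 := congrArg Prod.fst he
  have hz : op r • (e g).2 = 0 := congrArg Prod.snd he
  have hg' : op (idem K a) • e g = e g := by rw [← map_smul, hg]
  have hya : op (idem K a) • (e g).1 = (e g).1 := congrArg Prod.fst hg'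
  have hza : op (idem K a) • (e g).2 = (e g).2 := congrArg Prod.snd hg'
  by_cases hc : vertexCoeff a r = 0
  · left
    have hrad : IsRad (idem K a * r * idem K a) := fun b => by
      rw [map_mul, map_mul]
      by_cases hab : a = b
      · rw [← hab, hc, mul_zero, zero_mul]
      · rw [vertexCoeff_idem_of_ne hab, mul_zero]
    have h1 : op (idem K a * r * idem K a) • (e g).1 = (e g).1 := by
      rw [← op_smul_op_smul, ← op_smul_op_smul, hya, hy, hya]
    have h2 : (e g).1 = 0 := by
      rw [← h1, ← h1, op_smul_op_smul, hrad.mul_eq_zero hrad, MulOpposite.op_zero, zero_smul]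
    refine subsingleton_of_forall_eq 0 fun x => ?_
    obtain ⟨t, ht⟩ := hgen (e.symm (x, 0))
    have h3 := congrArg e ht
    rw [map_smul, LinearEquiv.apply_symm_apply] at h3
    rw [← show op t • (e g).1 = x from congrArg Prod.fst h3, h2, smul_zero]
  · right
    obtain ⟨u, hu⟩ := exists_mul_eq_smul_idem a r
    have h1 : op (idem K a * r * idem K a * u) • (e g).2 = 0 := by
      rw [← op_smul_op_smul, ← op_smul_op_smul, ← op_smul_op_smul, hza, hz, smul_zero, smul_zero]
    rw [hu, op_kSmul_smul, hza] at h1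
    have h2 := op_algebraMap_smul_eq_zero (mul_ne_zero hc hc) h1
    refine subsingleton_of_forall_eq 0 fun x => ?_
    obtain ⟨t, ht⟩ := hgen (e.symm (0, x))
    have h3 := congrArg e ht
    rw [map_smul, LinearEquiv.apply_symm_apply] at h3
    rw [← show op t • (e g).2 = x from congrArg Prod.snd h3, h2, smul_zero]

variable (K) in
/-- The quotient of `e_a A` by the submodule generated by an arrow. -/
def arrowQuotient {a b : V} (α : a ⟶ b) : FGModuleCat (RadSqZero K V)ᵐᵒᵖ :=
  FGModuleCat.of _ (proj K a ⧸ arrowSpan K α)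

theorem isIndecomposable_arrowQuotient {a b : V} (α : a ⟶ b) :
    IsIndecomposable (arrowQuotient K α) := by
  let g : proj K a := ⟨idem K a, idem_mem_proj a⟩
  have hne : (arrowSpan K α).mkQ g ≠ 0 := by
    rw [Ne, Submodule.mkQ_apply, Submodule.Quotient.mk_eq_zero]
    intro h
    have := isRad_of_mem_arrowSpan h a
    rw [vertexCoeff_idem_self] at this
    exact one_ne_zero this
  have : Nontrivial (arrowQuotient K α) := ⟨_, _, hne⟩
  refine isIndecomposable_of_homog_generator (a := a) (g := (arrowSpan K α).mkQ g) ?_ ?_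
  · exact congrArg (arrowSpan K α).mkQ (Subtype.ext (idem_mul_idem_self a) :
      op (idem K a) • g = g)
  · rw [eq_top_iff]
    intro y _
    obtain ⟨x, rfl⟩ := (arrowSpan K α).mkQ_surjective y
    have hx : x = op x.1 • g := Subtype.ext (mem_proj.1 x.2).symm
    refine Submodule.mem_span_singleton.2 ⟨op x.1, ?_⟩
    conv_rhs => rw [hx, map_smul]
    rfl

/-- The kernel of e_a A → e_a A/αA is αA, which equals the line Kα and is a copy of S_b. -/
theorem omegaBar_cls_arrowQuotient {a b : V} (α : a ⟶ b) :
    omegaBar (cls (arrowQuotient K α)) = cls (simpleObj K b) := by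
  let P : FGModuleCat (RadSqZero K V)ᵐᵒᵖ := FGModuleCat.of _ (proj K a)
  have h := omegaBar_cls_eq_ker (M := arrowQuotient K α) (P := P) (arrowSpan K α).mkQ
    (inferInstanceAs (Module.Projective _ (proj K a))) (arrowSpan K α).mkQ_surjective
  rw [h]
  have hker : ∀ {x : proj K a}, (arrowSpan K α).mkQ x = 0 ↔ x ∈ arrowSpan K α :=
    Submodule.Quotient.mk_eq_zero _
  let m : kerObj (M := arrowQuotient K α) (P := P) (arrowSpan K α).mkQ :=
    ⟨⟨arrow α, arrow_mem_proj α⟩, hker.2 (Submodule.subset_span rfl)⟩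
  rw [cls_eq_sum_of_basis (fun _ : Fin 1 => b) (fun _ => m)]
  · simp
  · exact fun _ j hj => Subtype.ext (Subtype.ext ((isRad_arrow α).mul_eq_zero hj))
  · exact fun _ => Subtype.ext (Subtype.ext (arrow_mul_idem α))
  · rw [eq_top_iff]
    intro x _
    obtain ⟨r, hr⟩ := Submodule.mem_span_singleton.1 (hker.1 x.2)
    rw [Set.range_const]
    exact Submodule.mem_span_singleton.2 ⟨r, Subtype.ext hr⟩
  · intro c hc
    rw [Fin.sum_univ_one] at hc
    have h1 : op (algebraMap K (RadSqZero K V) (c 0)) • (arrow α : RadSqZero K V) = 0 :=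
      congrArg (fun x : kerObj (M := arrowQuotient K α) (P := P) (arrowSpan K α).mkQ => x.1.1) hc
    have h2 := congrArg (arrowCoeff α) h1
    rw [op_algebraMap_smul_eq, arrowCoeff_smul, arrowCoeff_arrow_self, mul_one, map_zero] at h2
    funext i
    rw [Subsingleton.elim i 0]
    exact h2

/-- Without sources, every virtual semisimple module is a virtual syzygy, uniformly. -/
theorem exists_module_omegaBar_surjective (hV : ∀ a : V, ¬ IsSource a) :
    ∃ M : FGModuleCat (RadSqZero K V)ᵐᵒᵖ, ∀ c : V → ℤ, ∃ x ∈ addSpan M,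
      omegaBar x = simpleClass K V c := by
  classical
  have H : ∀ b : V, ∃ a : V, Nonempty (a ⟶ b) := fun b => by
    obtain ⟨a, ha⟩ := not_forall.1 (hV b)
    exact ⟨a, not_isEmpty_iff.1 ha⟩
  choose a ha using H
  let α : ∀ b : V, a b ⟶ b := fun b => (ha b).some
  let M : FGModuleCat (RadSqZero K V)ᵐᵒᵖ := FGModuleCat.of _ (Π b, arrowQuotient K (α b))
  refine ⟨M, fun c => ⟨∑ b, c b • cls (arrowQuotient K (α b)), ?_, ?_⟩⟩
  · exact AddSubgroup.sum_mem _ fun b _ => AddSubgroup.zsmul_mem _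
      (cls_mem_addSpan_pi (fun b => arrowQuotient K (α b)) M (LinearEquiv.refl _ _)
        (isIndecomposable_arrowQuotient (α b))) _
  · rw [map_sum, simpleClass_apply]
    simp only [map_zsmul, omegaBar_cls_arrowQuotient]

end Uniserial

section Support

variable {K : Type w} [Field K] {V : Type u} [Quiver.{v + 1} V] [Fintype V]

/-! ### Supports of syzygies and cosyzygies -/

/-- Suppose y = y e_a ≠ 0 lies in the kernel and `a` is a source. Because A e_a = K e_a, any linear
functional on P e_a has a kernel that extends to a submodule of P. One with f(y) ≠ 0 gives a proper
submodule that together with y spans P, so the kernel is not superfluous. -/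
theorem not_isSource_of_mem_support [∀ a b : V, Fintype (a ⟶ b)]
    {M N : FGModuleCat (RadSqZero K V)ᵐᵒᵖ} (h : IsSyzygy M N)
    {a : V} (ha : a ∈ support N) : ¬ IsSource a := by
  intro hsource
  obtain ⟨P, π, ⟨-, -, hsup⟩, ⟨e⟩⟩ := h
  obtain ⟨x, hx⟩ := ha
  set y : P := op (idem K a) • (e x).1 with hy
  have hy0 : y ≠ 0 := by
    intro h0
    apply hx
    apply e.injective
    rw [map_smul, map_zero]
    exact Subtype.ext h0
  have hya : op (idem K a) • y = y := isHomog_op_idem_smul a (e x).1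
  have hyker : y ∈ LinearMap.ker π := Submodule.smul_mem _ _ (e x).2
  let _ : Module K P := Module.compHom P (algebraMap K (RadSqZero K V)ᵐᵒᵖ)
  have hK : ∀ (c : K) (p : P), c • p = op (algebraMap K (RadSqZero K V) c) • p := fun _ _ => rfl
  obtain ⟨f, hf⟩ := Module.Projective.exists_dual_ne_zero K hy0
  let N' : Submodule (RadSqZero K V)ᵐᵒᵖ P :=
    { carrier := {p | f (op (idem K a) • p) = 0}
      zero_mem' := by simp
      add_mem' := fun {p q} hp hq => by
        change f _ = 0
        rw [smul_add, map_add, hp, hq, add_zero]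
      smul_mem' := fun r p hp => by
        change f (op (idem K a) • op (unop r) • p) = 0
        rw [op_smul_op_smul, mul_idem_of_isSource hsource, op_kSmul_smul, ← hK, map_smul, hp,
          smul_zero] }
  have htop : N' = ⊤ := hsup N' (by
    rw [eq_top_iff]
    intro p _
    refine Submodule.mem_sup.2 ⟨p - (f (op (idem K a) • p) / f y) • y, ?_,
      (f (op (idem K a) • p) / f y) • y, ?_, sub_add_cancel _ _⟩
    · change f (op (idem K a) • (p - (f (op (idem K a) • p) / f y) • y)) = 0
      rw [smul_sub, hK, op_smul_op_algebraMap_smul, hya, ← hK, map_sub,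
        f.map_smul (f (op (idem K a) • p) / f y) y, smul_eq_mul,
        div_mul_cancel₀ _ hf, sub_self]
    · rw [hK]
      exact Submodule.smul_mem _ _ hyker)
  have hmem : y ∈ N' := htop ▸ Submodule.mem_top
  have : f (op (idem K a) • y) = 0 := hmem
  rw [hya] at this
  exact hf this

/-- At a sink e_a A = K e_a, so z e_a generates a submodule that is at most a line. If z e_a is
outside the image of `ι`, this line meets the image in zero, against essentiality. -/
theorem not_isSink_of_mem_support [∀ a b : V, Fintype (a ⟶ b)]
    {M N : FGModuleCat (RadSqZero K V)ᵐᵒᵖ} (h : IsCosyzygy M N)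
    {a : V} (ha : a ∈ support N) : ¬ IsSink a := by
  intro hsink
  obtain ⟨E, ι, ⟨-, -, hess⟩, ⟨e⟩⟩ := h
  obtain ⟨x, hx⟩ := ha
  obtain ⟨z, hz⟩ := (LinearMap.range ι).mkQ_surjective (e x)
  have hy : op (idem K a) • z ∉ LinearMap.range ι := by
    intro hmem
    apply hx
    apply e.injective
    rw [map_smul, map_zero, ← hz, ← map_smul]
    exact (Submodule.Quotient.mk_eq_zero _).2 hmem
  have hbot := hess (Submodule.span _ {op (idem K a) • z}) (by
    rw [eq_bot_iff]
    rintro y ⟨hy1, hy2⟩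
    obtain ⟨r, rfl⟩ := Submodule.mem_span_singleton.1 hy1
    have h1 : r • op (idem K a) • z =
        op (algebraMap K (RadSqZero K V) (vertexCoeff a (unop r))) • op (idem K a) • z := by
      rw [← op_kSmul_smul, ← idem_mul_of_isSink hsink, ← op_smul_op_smul, MulOpposite.op_unop]
    by_cases hc : vertexCoeff a (unop r) = 0
    · rw [h1, hc, map_zero, MulOpposite.op_zero, zero_smul]
      exact Submodule.zero_mem _
    · exfalso
      apply hy
      rw [h1] at hy2
      have h2 := Submodule.smul_mem _
        (op (algebraMap K (RadSqZero K V) (vertexCoeff a (unop r))⁻¹)) hy2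
      rwa [op_smul_op_smul, ← map_mul, mul_inv_cancel₀ hc, map_one, MulOpposite.op_one,
        one_smul] at h2)
  have h0 : op (idem K a) • z = 0 := by
    have : op (idem K a) • z ∈ Submodule.span (RadSqZero K V)ᵐᵒᵖ {op (idem K a) • z} :=
      Submodule.subset_span rfl
    rw [hbot] at this
    exact this
  exact hy (h0 ▸ Submodule.zero_mem _)

end Support

/-- The recursion peels off the first syzygy, whereas the support argument needs the last one. -/
theorem isNthSyzygy_succ_last {R : Type u} [Ring R] {n : ℕ} {M N : FGModuleCat.{u} R}
    (h : IsNthSyzygy (n + 1) M N) : ∃ L, IsSyzygy L N := by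
  induction n generalizing M with
  | zero =>
    obtain ⟨L, ⟨P, π, hπ, ⟨e⟩⟩, ⟨e'⟩⟩ := h
    exact ⟨M, P, π, hπ, ⟨e'.symm.trans e⟩⟩
  | succ n ih =>
    obtain ⟨L, -, h⟩ := h
    exact ih h

theorem isNthCosyzygy_succ_last {R : Type u} [Ring R] {n : ℕ} {M N : FGModuleCat.{u} R}
    (h : IsNthCosyzygy (n + 1) M N) : ∃ L, IsCosyzygy L N := by
  induction n generalizing M with
  | zero =>
    obtain ⟨L, ⟨P, π, hπ, ⟨e⟩⟩, ⟨e'⟩⟩ := h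
    exact ⟨M, P, π, hπ, ⟨e'.symm.trans e⟩⟩
  | succ n ih =>
    obtain ⟨L, -, h⟩ := h
    exact ih h

/-! ### Injective envelopes of semisimple modules -/

section Coinduced

variable {K : Type w} [Field K] {V : Type u} [Quiver.{v + 1} V] [Fintype V]

variable (K V) in
/-- The module coinduced from the semisimple subalgebra spanned by the idempotents. -/
def coind (L : Type*) [AddCommGroup L] [Module (RadSqZero K V)ᵐᵒᵖ L] :
    AddSubgroup (RadSqZero K V →+ L) where
  carrier := {f | (∀ x a, f (x * idem K a) = op (idem K a) • f x) ∧
    ∀ (c : K) x, f (c • x) = op (algebraMap K (RadSqZero K V) c) • f x}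
  zero_mem' := ⟨fun _ _ => (smul_zero _).symm, fun _ _ => (smul_zero _).symm⟩
  add_mem' {f g} hf hg := ⟨fun x a => by
    rw [AddMonoidHom.add_apply, AddMonoidHom.add_apply, hf.1, hg.1, smul_add], fun c x => by
    rw [AddMonoidHom.add_apply, AddMonoidHom.add_apply, hf.2, hg.2, smul_add]⟩
  neg_mem' {f} hf := ⟨fun x a => by
    rw [AddMonoidHom.neg_apply, AddMonoidHom.neg_apply, hf.1, smul_neg], fun c x => by
    rw [AddMonoidHom.neg_apply, AddMonoidHom.neg_apply, hf.2, smul_neg]⟩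

variable {L : Type*} [AddCommGroup L] [Module (RadSqZero K V)ᵐᵒᵖ L]

instance : SMul (RadSqZero K V)ᵐᵒᵖ (coind K V L) where
  smul r f := ⟨f.1.comp (AddMonoidHom.mulLeft (unop r)), fun x a => by
    change f.1 (unop r * (x * idem K a)) = _ • f.1 (unop r * x)
    rw [← mul_assoc, f.2.1], fun c x => by
    change f.1 (unop r * (c • x)) = _ • f.1 (unop r * x)
    rw [mul_smul_comm, f.2.2]⟩

theorem coind_smul_apply (r : (RadSqZero K V)ᵐᵒᵖ) (f : coind K V L) (x : RadSqZero K V) :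
    (r • f).1 x = f.1 (unop r * x) := rfl

theorem coind_ext {f g : coind K V L} (h : ∀ x, f.1 x = g.1 x) : f = g :=
  Subtype.ext (AddMonoidHom.ext h)

theorem coind_add_apply (f g : coind K V L) (x : RadSqZero K V) :
    (f + g).1 x = f.1 x + g.1 x := rfl

theorem coind_zero_apply (x : RadSqZero K V) : (0 : coind K V L).1 x = 0 := rfl

instance : Module (RadSqZero K V)ᵐᵒᵖ (coind K V L) where
  one_smul f := coind_ext fun x => by
    rw [coind_smul_apply, MulOpposite.unop_one, one_mul]
  mul_smul r s f := coind_ext fun x => by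
    rw [coind_smul_apply, coind_smul_apply, coind_smul_apply, MulOpposite.unop_mul, mul_assoc]
  smul_zero r := rfl
  smul_add r f g := rfl
  add_smul r s f := coind_ext fun x => by
    rw [coind_add_apply, coind_smul_apply, coind_smul_apply, coind_smul_apply,
      MulOpposite.unop_add, add_mul, map_add]
  zero_smul f := coind_ext fun x => by
    rw [coind_smul_apply, MulOpposite.unop_zero, zero_mul, map_zero, coind_zero_apply]

/-- The unit of coinduction. -/
def toCoind : L →ₗ[(RadSqZero K V)ᵐᵒᵖ] coind K V L where
  toFun l := ⟨
    { toFun := fun x => op x • l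
      map_zero' := by rw [MulOpposite.op_zero, zero_smul]
      map_add' := fun x y => by rw [MulOpposite.op_add, add_smul] },
    fun x a => (op_smul_op_smul _ _ _).symm, fun c x => op_kSmul_smul _ _ _⟩
  map_add' l m := coind_ext fun x => smul_add _ _ _
  map_smul' r l := coind_ext fun x => op_smul_op_smul _ (unop r) _

theorem toCoind_apply (l : L) (x : RadSqZero K V) : (toCoind l : coind K V L).1 x = op x • l := rfl

theorem toCoind_injective : Function.Injective (toCoind : L →ₗ[_] coind K V L) := by
  intro l m h
  have := congrArg (fun f : coind K V L => f.1 1) h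
  simpa [toCoind_apply] using this

/-- Coinduction adjunction: a map from `I` into the coinduced module is determined by its values at
1, a K-linear map `I` → `L`. This extends over the field, and the extension is made compatible with
the idempotents. -/
theorem coind_baer : Module.Baer (RadSqZero K V)ᵐᵒᵖ (coind K V L) := by
  classical
  intro I g
  let _ : Module K L := Module.compHom L (algebraMap K (RadSqZero K V)ᵐᵒᵖ)
  have hK : ∀ (c : K) (p : L), c • p = op (algebraMap K (RadSqZero K V) c) • p := fun _ _ => rfl
  let g₁ : I.restrictScalars K →ₗ[K] L :=
    { toFun := fun i => (g ⟨i.1, i.2⟩).1 1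
      map_add' := fun i j => by
        rw [← coind_add_apply, ← map_add]; rfl
      map_smul' := fun c i => by
        have h : g ⟨(c • i).1, (c • i).2⟩ = op (algebraMap K (RadSqZero K V) c) • g ⟨i.1, i.2⟩ := by
          rw [← map_smul]
          congr 1
          refine Subtype.ext ?_
          change c • i.1 = op (algebraMap K (RadSqZero K V) c) * i.1
          rw [Algebra.smul_def]
          rfl
        rw [h, coind_smul_apply, RingHom.id_apply, hK, mul_one, MulOpposite.unop_op,
          ← (g ⟨i.1, i.2⟩).2.2, Algebra.smul_def, mul_one] }
  obtain ⟨h₀, hh₀⟩ := LinearMap.exists_extend g₁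
  have hext : ∀ r (hr : r ∈ I), h₀ r = (g ⟨r, hr⟩).1 1 := fun r hr =>
    LinearMap.congr_fun hh₀ ⟨r, hr⟩
  -- The extension `h₀` is only K-linear. Summing its e_a-components over all vertices makes it
  -- commute with the idempotents and changes nothing where it already did.
  let h : coind K V L := ⟨
    { toFun := fun x => ∑ a : V, op (idem K a) • h₀ (op (x * idem K a))
      map_zero' := by simp
      map_add' := fun x y => by
        simp only [add_mul, MulOpposite.op_add, map_add, smul_add, Finset.sum_add_distrib] },
    fun x b => by
      change ∑ a : V, op (idem K a) • h₀ (op (x * idem K b * idem K a)) =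
        op (idem K b) • ∑ a : V, op (idem K a) • h₀ (op (x * idem K a))
      rw [Finset.smul_sum]
      refine Finset.sum_congr rfl fun a _ => ?_
      rw [op_smul_op_smul, mul_assoc]
      by_cases hab : b = a
      · subst hab; rw [idem_mul_idem_self]
      · rw [idem_mul_idem_of_ne hab, idem_mul_idem_of_ne (Ne.symm hab)]; simp,
    fun c x => by
      change ∑ a : V, op (idem K a) • h₀ (op (c • x * idem K a)) =
        _ • ∑ a : V, op (idem K a) • h₀ (op (x * idem K a))
      rw [Finset.smul_sum]
      refine Finset.sum_congr rfl fun a _ => ?_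
      rw [smul_mul_assoc, MulOpposite.op_smul, map_smul, hK, op_smul_op_algebraMap_smul]⟩
  refine ⟨LinearMap.toSpanSingleton _ _ h, fun r hr => coind_ext fun x => ?_⟩
  rw [LinearMap.toSpanSingleton_apply, coind_smul_apply]
  change ∑ a : V, op (idem K a) • h₀ (op (unop r * x * idem K a)) = _
  have key : ∀ a : V, h₀ (op (unop r * x * idem K a)) = op (idem K a) • (g ⟨r, hr⟩).1 x := by
    intro a
    have hmem : op (x * idem K a) * r ∈ I := I.mul_mem_left _ hr
    have h1 : op (unop r * x * idem K a) = op (x * idem K a) * r := by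
      rw [mul_assoc]; rfl
    rw [h1, hext _ hmem]
    have h2 : g ⟨op (x * idem K a) * r, hmem⟩ = op (x * idem K a) • g ⟨r, hr⟩ := by
      rw [← map_smul]; rfl
    rw [h2, coind_smul_apply, MulOpposite.unop_op, mul_one, (g ⟨r, hr⟩).2.1]
  simp only [key, op_smul_op_smul, idem_mul_idem_self]
  exact sum_op_idem_smul _

theorem InSocle.op_smul_eq_sum {l : L} (hl : InSocle (K := K) (V := V) l) (x : RadSqZero K V) :
    op x • l = ∑ a : V, op (algebraMap K (RadSqZero K V) (vertexCoeff a x)) • op (idem K a) • l := by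
  conv_lhs => rw [← sum_op_idem_smul (K := K) (V := V) l, Finset.smul_sum]
  exact Finset.sum_congr rfl fun a _ =>
    (hl.op_smul (idem K a)).op_smul_of_isHomog (isHomog_op_idem_smul a l) x

/-- The coinduced element supported at an arrow. -/
def arrowCoind {s t : V} (α : s ⟶ t) {y : L} (hy : IsHomog (K := K) t y) : coind K V L :=
  ⟨{ toFun := fun x => op (algebraMap K (RadSqZero K V) (arrowCoeff α x)) • y
     map_zero' := by simp
     map_add' := fun x z => by rw [map_add, map_add, MulOpposite.op_add, add_smul] },
    fun x a => by
      change op (algebraMap K (RadSqZero K V) (arrowCoeff α (x * idem K a))) • y =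
        op (idem K a) • op (algebraMap K (RadSqZero K V) (arrowCoeff α x)) • y
      rw [op_smul_op_algebraMap_smul, arrowCoeff_mul, arrowCoeff_idem, mul_zero, zero_add]
      by_cases hat : a = t
      · subst hat
        rw [vertexCoeff_idem_self, mul_one, hy]
      · rw [vertexCoeff_idem_of_ne hat, hy.op_idem_smul_of_ne (Ne.symm hat)]
        simp,
    fun c x => by
      change op (algebraMap K (RadSqZero K V) (arrowCoeff α (c • x))) • y =
        op (algebraMap K (RadSqZero K V) c) •
          op (algebraMap K (RadSqZero K V) (arrowCoeff α x)) • y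
      rw [arrowCoeff_smul, op_smul_op_smul, ← map_mul, mul_comm]⟩

theorem arrowCoind_apply_arrow {s t : V} (α : s ⟶ t) {y : L} (hy : IsHomog (K := K) t y) :
    (arrowCoind α hy).1 (arrow α) = y := by
  change op (algebraMap K (RadSqZero K V) (arrowCoeff α (arrow α))) • y = y
  rw [arrowCoeff_arrow_self, map_one, MulOpposite.op_one, one_smul]

section Finite

variable [∀ a b : V, Fintype (a ⟶ b)]

instance coind_finite [Module.Finite (RadSqZero K V)ᵐᵒᵖ L] :
    Module.Finite (RadSqZero K V)ᵐᵒᵖ (coind K V L) := by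
  let _ : Module K L := Module.compHom L (algebraMap K (RadSqZero K V)ᵐᵒᵖ)
  have : IsScalarTower K (RadSqZero K V)ᵐᵒᵖ L := ⟨fun c r l => by
    change (c • r) • l = algebraMap K (RadSqZero K V)ᵐᵒᵖ c • r • l
    rw [Algebra.smul_def, mul_smul]⟩
  let _ : Module K (coind K V L) := Module.compHom _ (algebraMap K (RadSqZero K V)ᵐᵒᵖ)
  have : IsScalarTower K (RadSqZero K V)ᵐᵒᵖ (coind K V L) := ⟨fun c r l => by
    change (c • r) • l = algebraMap K (RadSqZero K V)ᵐᵒᵖ c • r • l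
    rw [Algebra.smul_def, mul_smul]⟩
  have : Module.Finite K L := Module.Finite.trans (RadSqZero K V)ᵐᵒᵖ L
  let F : coind K V L →ₗ[K] (RadSqZero K V →ₗ[K] L) :=
    { toFun := fun f => { f.1 with map_smul' := fun c x => f.2.2 c x }
      map_add' := fun f g => rfl
      map_smul' := fun c f => LinearMap.ext fun x => by
        change f.1 (algebraMap K (RadSqZero K V) c * x) =
          op (algebraMap K (RadSqZero K V) c) • f.1 x
        rw [← Algebra.smul_def, f.2.2] }
  have : Module.Finite K (coind K V L) := Module.Finite.of_injective F fun f g h =>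
    coind_ext fun x => LinearMap.congr_fun h x
  exact Module.Finite.of_restrictScalars_finite K (RadSqZero K V)ᵐᵒᵖ (coind K V L)

/-- The radical maps a coinduced module into the original semisimple module. -/
theorem IsRad.op_smul_coind (hL : ∀ l : L, InSocle (K := K) (V := V) l) {j : RadSqZero K V}
    (hj : IsRad j) (f : coind K V L) : op j • f = toCoind (f.1 j) := by
  refine coind_ext fun x => ?_
  rw [coind_smul_apply, MulOpposite.unop_op, toCoind_apply, (hL _).op_smul_eq_sum, hj.mul_eq_sum,
    map_sum]
  exact Finset.sum_congr rfl fun a _ => by rw [f.2.2, f.2.1]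

/-- The radical carries any `f` in `N` into the image of `L`, hence to zero, so `f` vanishes on
radical elements. Then `f` is itself the image of f(1), and so lies in the zero intersection. -/
theorem coind_essential (hL : ∀ l : L, InSocle (K := K) (V := V) l)
    {N : Submodule (RadSqZero K V)ᵐᵒᵖ (coind K V L)}
    (hN : N ⊓ LinearMap.range (toCoind : L →ₗ[_] coind K V L) = ⊥) : N = ⊥ := by
  rw [eq_bot_iff]
  intro f hf
  have hrad : ∀ j : RadSqZero K V, IsRad j → f.1 j = 0 := by
    intro j hj
    have h1 : op j • f ∈ N ⊓ LinearMap.range (toCoind : L →ₗ[_] coind K V L) :=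
      ⟨N.smul_mem _ hf, ⟨_, (hj.op_smul_coind hL f).symm⟩⟩
    rw [hN, Submodule.mem_bot, hj.op_smul_coind hL] at h1
    exact toCoind_injective (h1.trans (map_zero _).symm)
  have h2 : f = toCoind (f.1 1) := by
    refine coind_ext fun x => ?_
    rw [toCoind_apply, (hL _).op_smul_eq_sum]
    conv_lhs => rw [eq_sum_coeff x]
    rw [map_add, map_sum, map_sum, Finset.sum_eq_zero (s := Finset.univ (α := Σ a b : V, (a ⟶ b))),
      add_zero]
    · exact Finset.sum_congr rfl fun a _ => by rw [f.2.2, ← f.2.1, one_mul]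
    · intro α _
      rw [f.2.2, hrad _ (isRad_arrow _), smul_zero]
  have h3 : f ∈ N ⊓ LinearMap.range (toCoind : L →ₗ[_] coind K V L) := ⟨hf, ⟨_, h2.symm⟩⟩
  rwa [hN] at h3

end Finite

end Coinduced

/-! ### The heart of a quiver without sinks and sources -/

section Heart

variable {K : Type w} [Field K] {V : Type u} [Quiver.{v + 1} V] [Fintype V]

/-- A semisimple module in which every simple module occurs. -/
def IsFullSemisimple (L : FGModuleCat (RadSqZero K V)ᵐᵒᵖ) : Prop :=
  (∀ l : L, InSocle (K := K) (V := V) l) ∧ ∀ a : V, a ∈ support L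

variable [∀ a b : V, Fintype (a ⟶ b)]

theorem isFullSemisimple_semisimpleTop : IsFullSemisimple (semisimpleTop K V) := by
  refine ⟨fun l j hj => ?_, fun a => ⟨(radSubmodule K V).mkQ (idem K a), ?_⟩⟩
  · obtain ⟨x, rfl⟩ := (radSubmodule K V).mkQ_surjective l
    exact (Submodule.Quotient.mk_eq_zero _).2
      ((isRad_iff_mem_radSubmodule _).1 (hj.mul_left x) : x * j ∈ radSubmodule K V)
  · intro h
    have h1 : idem K a * idem K a ∈ radSubmodule K V := (Submodule.Quotient.mk_eq_zero _).1 h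
    have h2 := (isRad_iff_mem_radSubmodule _).2 h1 a
    rw [idem_mul_idem_self, vertexCoeff_idem_self] at h2
    exact one_ne_zero h2

/-- For an arrow α : s → b, lift an element of L e_s to x' = x' e_s. Then x'α is in the kernel and
is fixed by e_b; were it zero, x' would be radical and map to zero in `L`. -/
theorem IsFullSemisimple.exists_isSyzygy (hV : ∀ a : V, ¬ IsSource a)
    {L : FGModuleCat (RadSqZero K V)ᵐᵒᵖ} (hL : IsFullSemisimple L) :
    ∃ N, IsSyzygy L N ∧ IsFullSemisimple N := by
  classical
  obtain ⟨k, a, π, hπ, hker⟩ := exists_cover_with_isRad_kernel L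
  let P : FGModuleCat (RadSqZero K V)ᵐᵒᵖ := FGModuleCat.of _ (Π i, proj K (a i))
  refine ⟨kerObj (P := P) π, ⟨P, π, ⟨inferInstanceAs (Module.Projective _ (Π i, proj K (a i))), hπ,
    fun N hN => superfluous_of_isRad hker hN⟩, ⟨LinearEquiv.refl _ _⟩⟩, fun x j hj =>
    Subtype.ext (inSocle_of_isRad (hker x.1 x.2) j hj), fun b => ?_⟩
  obtain ⟨s, hs⟩ := not_forall.1 (hV b)
  obtain ⟨α⟩ := not_isEmpty_iff.1 hs
  obtain ⟨y, hy⟩ := hL.2 s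
  obtain ⟨x, hx⟩ := hπ y
  let x' : Π i, proj K (a i) := op (idem K s) • x
  have hx' : π x' ≠ 0 := by
    rw [map_smul, hx]; exact hy
  have hmem : π ((op (arrow α) : (RadSqZero K V)ᵐᵒᵖ) • x') = 0 := by
    rw [map_smul]; exact hL.1 _ _ (isRad_arrow α)
  refine ⟨⟨(op (arrow α) : (RadSqZero K V)ᵐᵒᵖ) • x', hmem⟩, fun h0 => hx' ?_⟩
  have h1 : op (idem K b) • (op (arrow α) : (RadSqZero K V)ᵐᵒᵖ) • x' = 0 :=
    congrArg Subtype.val h0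
  have hrad : ∀ i, IsRad (x' i).1 := by
    intro i c
    by_cases hsc : s = c
    · subst hsc
      have h2 : (x' i).1 * arrow α * idem K b = 0 := congrArg Subtype.val (congrFun h1 i)
      rw [mul_assoc, arrow_mul_idem] at h2
      have h3 := congrArg (arrowCoeff α) h2
      rwa [arrowCoeff_mul, arrowCoeff_arrow_self, vertexCoeff_arrow, mul_one, mul_zero, add_zero,
        map_zero] at h3
    · change vertexCoeff c ((x i).1 * idem K s) = 0
      rw [map_mul, vertexCoeff_idem_of_ne hsc, mul_zero]
  rw [eq_sum_op_smul_single x', map_sum]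
  refine Finset.sum_eq_zero fun i _ => ?_
  rw [map_smul]
  exact hL.1 _ _ (hrad i)

/-- For an arrow α : a → t, the coinduced map sending α to a nonzero element of L e_t is not in the
image of `L`, whose elements all vanish on the radical. -/
theorem IsFullSemisimple.exists_isCosyzygy (hV : ∀ a : V, ¬ IsSink a)
    {L : FGModuleCat (RadSqZero K V)ᵐᵒᵖ} (hL : IsFullSemisimple L) :
    ∃ N, IsCosyzygy L N ∧ IsFullSemisimple N := by
  let E : FGModuleCat (RadSqZero K V)ᵐᵒᵖ := FGModuleCat.of _ (coind K V L)
  let ι : L →ₗ[(RadSqZero K V)ᵐᵒᵖ] coind K V L := toCoind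
  refine ⟨FGModuleCat.of _ (coind K V L ⧸ LinearMap.range ι),
    ⟨E, ι, ⟨coind_baer.injective, toCoind_injective, fun N hN => coind_essential hL.1 hN⟩,
    ⟨LinearEquiv.refl _ _⟩⟩, fun y j hj => ?_, fun a => ?_⟩
  · obtain ⟨f, rfl⟩ := (LinearMap.range ι).mkQ_surjective y
    exact (Submodule.Quotient.mk_eq_zero _).2
      (⟨_, (hj.op_smul_coind hL.1 f).symm⟩ : op j • f ∈ LinearMap.range ι)
  · obtain ⟨t, ht⟩ := not_forall.1 (hV a)
    obtain ⟨α⟩ := not_isEmpty_iff.1 ht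
    obtain ⟨y, hy⟩ := hL.2 t
    let f : coind K V L := arrowCoind α (isHomog_op_idem_smul t y)
    refine ⟨(LinearMap.range ι).mkQ f, fun h => ?_⟩
    obtain ⟨l, hl⟩ : op (idem K a) • f ∈ LinearMap.range ι := (Submodule.Quotient.mk_eq_zero _).1 h
    have h1 := congrArg (fun f : coind K V L => f.1 (arrow α)) hl
    apply hy
    have h2 : (op (idem K a) • f).1 (arrow α) = op (idem K t) • y := by
      rw [coind_smul_apply, MulOpposite.unop_op, idem_mul_arrow]
      exact arrowCoind_apply_arrow α _
    rw [← h2, ← h1]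
    exact hL.1 l _ (isRad_arrow α)

theorem IsFullSemisimple.exists_isNthSyzygy (hV : ∀ a : V, ¬ IsSource a) (n : ℕ)
    {L : FGModuleCat (RadSqZero K V)ᵐᵒᵖ} (hL : IsFullSemisimple L) :
    ∃ N, IsNthSyzygy n L N ∧ IsFullSemisimple N := by
  induction n generalizing L with
  | zero => exact ⟨L, ⟨LinearEquiv.refl _ _⟩, hL⟩
  | succ n ih =>
    obtain ⟨L', h, hL'⟩ := hL.exists_isSyzygy hV
    obtain ⟨N, hN, hN'⟩ := ih hL'
    exact ⟨N, ⟨L', h, hN⟩, hN'⟩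

theorem IsFullSemisimple.exists_isNthCosyzygy (hV : ∀ a : V, ¬ IsSink a) (n : ℕ)
    {L : FGModuleCat (RadSqZero K V)ᵐᵒᵖ} (hL : IsFullSemisimple L) :
    ∃ N, IsNthCosyzygy n L N ∧ IsFullSemisimple N := by
  induction n generalizing L with
  | zero => exact ⟨L, ⟨LinearEquiv.refl _ _⟩, hL⟩
  | succ n ih =>
    obtain ⟨L', h, hL'⟩ := hL.exists_isCosyzygy hV
    obtain ⟨N, hN, hN'⟩ := ih hL'
    exact ⟨N, ⟨L', h, hN⟩, hN'⟩

variable (K V) in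
/-- The member is empty if and only if there are neither sources nor sinks. -/
theorem member_eq_empty_iff :
    member K V = ∅ ↔ (∀ a : V, ¬ IsSource a) ∧ ∀ a : V, ¬ IsSink a := by
  rw [member, Set.compl_empty_iff, Set.eq_univ_iff_forall]
  constructor
  · intro h
    refine ⟨fun a => ?_, fun a => ?_⟩ <;>
    -- The vertex `a` itself shows that at least one syzygy or cosyzygy is taken.
    obtain ⟨n, hn⟩ : ∃ n, Fintype.card V = n + 1 :=
      ⟨_, (Nat.succ_pred_eq_of_pos (Fintype.card_pos_iff.2 ⟨a⟩)).symm⟩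
    · obtain ⟨⟨N, hN, ha⟩, -⟩ := h a
      rw [hn] at hN
      obtain ⟨L, hL⟩ := isNthSyzygy_succ_last hN
      exact not_isSource_of_mem_support hL ha
    · obtain ⟨-, N, hN, ha⟩ := h a
      rw [hn] at hN
      obtain ⟨L, hL⟩ := isNthCosyzygy_succ_last hN
      exact not_isSink_of_mem_support hL ha
  · rintro ⟨h1, h2⟩ a
    obtain ⟨N, hN, hN'⟩ := isFullSemisimple_semisimpleTop.exists_isNthSyzygy (K := K) h1
      (Fintype.card V)
    obtain ⟨N', hM, hM'⟩ := isFullSemisimple_semisimpleTop.exists_isNthCosyzygy (K := K) h2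
      (Fintype.card V)
    exact ⟨⟨N, hN, hN'.2 a⟩, ⟨N', hM, hM'.2 a⟩⟩

end Heart

/-! ### Jordan chains -/

section Chains

variable {F W : Type*} [Field F] [AddCommGroup W] [Module F W] {f : Module.End F W} {c e : W}
  {μ : F} {k : ℕ}

theorem pow_apply_eigenvector (he : f e = μ • e) (j : ℕ) : (f ^ j) e = μ ^ j • e := by
  induction j with
  | zero => simp
  | succ j ih => rw [pow_succ', Module.End.mul_apply, ih, map_smul, he, smul_smul, pow_succ]

theorem pow_apply_eq_zero_of_le (hk : (f ^ k) c = 0) {j : ℕ} (h : k ≤ j) : (f ^ j) c = 0 := by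
  rw [← Nat.sub_add_cancel h, pow_add, Module.End.mul_apply, hk, map_zero]

/-- A large power of `f` kills the chain but not the eigenvector, so b = 0; smaller powers isolate
the remaining coefficients in turn. The case l = 0 is linear independence, and l = 1 computes ker f.
-/
theorem chain_coeff_eq_zero (hk : (f ^ k) c = 0) (hk' : (f ^ (k - 1)) c ≠ 0) (hμ : μ ≠ 0)
    (he0 : e ≠ 0) (he : f e = μ • e) (l : ℕ) (a : Fin k → F) (b : F)
    (h : (f ^ l) (∑ i, a i • (f ^ (i : ℕ)) c + b • e) = 0) :
    (∀ i : Fin k, i + l < k → a i = 0) ∧ b = 0 := by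
  have hsum : ∀ r, (f ^ r) (∑ i, a i • (f ^ (i : ℕ)) c + b • e) =
      ∑ i, a i • (f ^ (r + i)) c + (b * μ ^ r) • e := fun r => by
    rw [map_add, map_sum, map_smul, pow_apply_eigenvector he, smul_smul]
    simp only [map_smul, pow_add, Module.End.mul_apply]
  have hr : ∀ r, l ≤ r → (f ^ r) (∑ i, a i • (f ^ (i : ℕ)) c + b • e) = 0 := fun r hlr =>
    pow_apply_eq_zero_of_le h hlr
  have hb : b = 0 := by
    have h1 := hr (k + l) (Nat.le_add_left l k)
    rw [hsum, Finset.sum_eq_zero, zero_add, smul_eq_zero] at h1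
    · exact (mul_eq_zero.1 (h1.resolve_right he0)).resolve_right (pow_ne_zero _ hμ)
    · intro i _
      rw [pow_apply_eq_zero_of_le hk (by omega), smul_zero]
  refine ⟨fun i => ?_, hb⟩
  obtain ⟨j, hj⟩ := i
  induction j using Nat.strong_induction_on with
  | _ j ih =>
    intro hjl
    change j + l < k at hjl
    -- This power kills the terms beyond `j`, and the earlier coefficients vanish by induction,
    -- leaving a_j f^(k-1) c. The exponent is at least `l` exactly because j + l < k.
    have h1 := hr (k - 1 - j) (by omega)
    rw [hsum, hb, zero_mul, zero_smul, add_zero, Finset.sum_eq_single ⟨j, hj⟩] at h1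
    · rw [show k - 1 - j + j = k - 1 by omega] at h1
      exact (smul_eq_zero.1 h1).resolve_right hk'
    · intro i _ hij
      by_cases hlt : (i : ℕ) < j
      · rw [ih i hlt i.2 (by change (i : ℕ) + l < k; omega), zero_smul]
      · have : (i : ℕ) ≠ j := fun h => hij (Fin.ext h)
        rw [pow_apply_eq_zero_of_le hk (by omega), smul_zero]
    · simp

/-- A nilpotent chain together with an eigenvector. -/
def chainFamily (f : Module.End F W) (c e : W) (k : ℕ) : (Σ i : Fin 2, Fin (![k, 1] i)) → W :=
  fun x => if x.1 = 0 then (f ^ (x.2 : ℕ)) c else e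

theorem sum_chainFamily (g : (Σ i : Fin 2, Fin (![k, 1] i)) → F) :
    ∑ x, g x • chainFamily f c e k x =
      ∑ i : Fin k, g ⟨0, i⟩ • (f ^ (i : ℕ)) c + g ⟨1, (0 : Fin 1)⟩ • e := by
  rw [Fintype.sum_sigma, Fin.sum_univ_two]
  congr 1
  exact Fin.sum_univ_one fun i : Fin 1 => g ⟨1, i⟩ • e

theorem linearIndependent_chainFamily (hk : (f ^ k) c = 0) (hk' : (f ^ (k - 1)) c ≠ 0)
    (hμ : μ ≠ 0) (he0 : e ≠ 0) (he : f e = μ • e) :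
    LinearIndependent F (chainFamily f c e k) := by
  rw [Fintype.linearIndependent_iff]
  intro g hg
  rw [sum_chainFamily] at hg
  obtain ⟨h1, h2⟩ := chain_coeff_eq_zero hk hk' hμ he0 he 0 (fun i => g ⟨0, i⟩) _ hg
  rintro ⟨i, j⟩
  fin_cases i
  · exact h1 j j.2
  · exact (congrArg (fun j => g ⟨1, j⟩) (Subsingleton.elim (α := Fin 1) j 0)).trans h2

theorem card_chain_index (k : ℕ) : Fintype.card (Σ i : Fin 2, Fin (![k, 1] i)) = k + 1 := by
  simp

end Chains

/-! ### Jordan forms with a nilpotent block and a nonzero eigenvalue -/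

section JordanForm

/-- The action on the basis vectors of a Jordan form with blocks `(0)` of size `k` and `(μ)`. -/
theorem toMatrix_eq_jordan_iff {k : ℕ} {μ : ℂ} {W : Type*} [AddCommGroup W] [Module ℂ W]
    {f : Module.End ℂ W} (b : Module.Basis (Σ i : Fin 2, Fin (![k, 1] i)) ℂ W) :
    (LinearMap.toMatrix b b f =
      Matrix.blockDiagonal' fun i => jordanBlock (![k, 1] i) (![0, μ] i)) ↔
    (∀ j : Fin k, f (b ⟨0, j⟩) = if h : (j : ℕ) + 1 < k then b ⟨0, (⟨j + 1, h⟩ : Fin k)⟩ else 0) ∧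
      f (b ⟨1, (0 : Fin 1)⟩) = μ • b ⟨1, (0 : Fin 1)⟩ := by
  set B := Matrix.blockDiagonal' fun i : Fin 2 => jordanBlock (![k, 1] i) (![0, μ] i) with hB
  have e00 : ∀ i j : Fin k, B ⟨0, i⟩ ⟨0, j⟩ = jordanBlock k 0 i j := fun i j =>
    Matrix.blockDiagonal'_apply_eq (fun i : Fin 2 => jordanBlock (![k, 1] i) (![0, μ] i)) 0 i j
  have e10 : ∀ (i : Fin 1) (j : Fin k), B ⟨1, i⟩ ⟨0, j⟩ = 0 := fun i j =>
    Matrix.blockDiagonal'_apply_ne (fun i : Fin 2 => jordanBlock (![k, 1] i) (![0, μ] i)) _ _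
      (by decide)
  have e01 : ∀ (i : Fin k) (j : Fin 1), B ⟨0, i⟩ ⟨1, j⟩ = 0 := fun i j =>
    Matrix.blockDiagonal'_apply_ne (fun i : Fin 2 => jordanBlock (![k, 1] i) (![0, μ] i)) _ _
      (by decide)
  have e11 : B ⟨1, (0 : Fin 1)⟩ ⟨1, (0 : Fin 1)⟩ = μ :=
    (Matrix.blockDiagonal'_apply_eq (fun i : Fin 2 => jordanBlock (![k, 1] i) (![0, μ] i)) 1
      (0 : Fin 1) (0 : Fin 1)).trans
        (by simp [jordanBlock] : jordanBlock 1 μ 0 0 = μ)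
  have hcol0 : ∀ j : Fin k, Matrix.toLin b b B (b ⟨0, j⟩) =
      if h : (j : ℕ) + 1 < k then b ⟨0, (⟨j + 1, h⟩ : Fin k)⟩ else 0 := by
    intro j
    rw [Matrix.toLin_self, Fintype.sum_sigma, Fin.sum_univ_two]
    change ∑ i : Fin k, B ⟨0, i⟩ ⟨0, j⟩ • b ⟨0, i⟩ + ∑ i : Fin 1, B ⟨1, i⟩ ⟨0, j⟩ • b ⟨1, i⟩ = _
    simp only [e00, e10, zero_smul, Finset.sum_const_zero, add_zero]
    change ∑ i : Fin k, (if i = j then (0 : ℂ) else if (i : ℕ) = j + 1 then 1 else 0) •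
      b ⟨0, i⟩ = _
    split_ifs with h
    · rw [Finset.sum_eq_single ⟨j + 1, h⟩]
      · rw [if_neg (by intro h; have := congrArg Fin.val h; simp at this), if_pos rfl, one_smul]
      · intro i _ hi
        rw [if_neg (c := (i : ℕ) = j + 1) (fun h' => hi (Fin.ext h')), ite_self, zero_smul]
      · simp
    · refine Finset.sum_eq_zero fun i _ => ?_
      rw [if_neg (c := (i : ℕ) = j + 1) (by omega), ite_self, zero_smul]
  have hcol1 : Matrix.toLin b b B (b ⟨1, (0 : Fin 1)⟩) = μ • b ⟨1, (0 : Fin 1)⟩ := by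
    rw [Matrix.toLin_self, Fintype.sum_sigma, Fin.sum_univ_two]
    change ∑ i : Fin k, B ⟨0, i⟩ ⟨1, (0 : Fin 1)⟩ • b ⟨0, i⟩ +
      ∑ i : Fin 1, B ⟨1, i⟩ ⟨1, (0 : Fin 1)⟩ • b ⟨1, i⟩ = _
    simp only [e01, zero_smul, Finset.sum_const_zero, zero_add]
    rw [Fin.sum_univ_one, e11]
  rw [← (Matrix.toLin b b).injective.eq_iff, Matrix.toLin_toMatrix]
  constructor
  · rintro rfl
    exact ⟨hcol0, hcol1⟩
  · rintro ⟨h0, h1⟩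
    refine b.ext ?_
    rintro ⟨i, j⟩
    fin_cases i
    · exact (h0 j).trans (hcol0 j).symm
    · have hj : j = (0 : Fin 1) := Subsingleton.elim (α := Fin 1) j 0
      subst hj
      exact h1.trans hcol1.symm

variable {V : Type*} [Fintype V] [DecidableEq V] {M : Matrix V V ℂ} {μ : ℂ} {k : ℕ}

/-- A nilpotent chain of length `k` and an eigenvector give a Jordan form. -/
theorem exists_basis_of_chain (hcard : Fintype.card V = k + 1) {c e : V → ℂ}
    (hk : (Matrix.toLin' M ^ k) c = 0) (hk' : (Matrix.toLin' M ^ (k - 1)) c ≠ 0)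
    (hμ : μ ≠ 0) (he0 : e ≠ 0) (he : Matrix.toLin' M e = μ • e) :
    ∃ b : Module.Basis (Σ i : Fin 2, Fin (![k, 1] i)) ℂ (V → ℂ),
      (b : _ → V → ℂ) = chainFamily (Matrix.toLin' M) c e k ∧ LinearMap.toMatrix b b
        (Matrix.toLin' M) =
          Matrix.blockDiagonal' fun i => jordanBlock (![k, 1] i) (![0, μ] i) := by
  have : Nonempty (Σ i : Fin 2, Fin (![k, 1] i)) := ⟨⟨1, (0 : Fin 1)⟩⟩
  have hli := linearIndependent_chainFamily hk hk' hμ he0 he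
  let b := basisOfLinearIndependentOfCardEqFinrank hli (by
    rw [card_chain_index, Module.finrank_fintype_fun_eq_card, hcard])
  have hb : (b : _ → V → ℂ) = chainFamily (Matrix.toLin' M) c e k :=
    coe_basisOfLinearIndependentOfCardEqFinrank _ _
  refine ⟨b, hb, (toMatrix_eq_jordan_iff b).2 ⟨fun j => ?_, ?_⟩⟩
  · rw [hb]
    change Matrix.toLin' M ((Matrix.toLin' M ^ (j : ℕ)) c) = _
    rw [← Module.End.mul_apply, ← pow_succ']
    split_ifs with h
    · rfl
    · exact pow_apply_eq_zero_of_le hk (not_lt.1 h)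
  · rw [hb]; exact he

theorem scalar_mulVec (μ : ℂ) (x : V → ℂ) : (Matrix.scalar V μ).mulVec x = μ • x := by
  ext i
  simp [Matrix.scalar_apply, Matrix.mulVec_diagonal]

/-- The matrix identities satisfied by a matrix with blocks `(0)` of size `k` and `(μ)`. -/
theorem HasJordanForm.pow_mul_sub (h : HasJordanForm M ![k, 1] ![0, μ]) (hk : 1 ≤ k)
    (hμ : μ ≠ 0) :
    M ^ k * (M - Matrix.scalar V μ) = 0 ∧ M ^ (k - 1) * (M - Matrix.scalar V μ) ≠ 0 := by
  obtain ⟨b, hb⟩ := h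
  obtain ⟨h0, h1⟩ := (toMatrix_eq_jordan_iff b).1 hb
  set f := Matrix.toLin' M with hf
  have hpow : ∀ i : ℕ, ∀ j : Fin k, (f ^ i) (b ⟨0, j⟩) =
      if h : (j : ℕ) + i < k then b ⟨0, (⟨j + i, h⟩ : Fin k)⟩ else 0 := by
    intro i
    induction i with
    | zero => intro j; simp
    | succ i ih =>
      intro j
      rw [pow_succ', Module.End.mul_apply, ih]
      by_cases hi : (j : ℕ) + i < k
      · rw [dif_pos hi, h0]; rfl
      · rw [dif_neg hi, map_zero, dif_neg (by omega)]
  have happ : ∀ (r : ℕ) (x : V → ℂ), Matrix.toLin' (M ^ r * (M - Matrix.scalar V μ)) x =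
      (f ^ (r + 1)) x - μ • (f ^ r) x := by
    intro r x
    rw [Matrix.toLin'_mul, Matrix.toLin'_pow, LinearMap.comp_apply, map_sub, LinearMap.sub_apply,
      Matrix.toLin'_apply (Matrix.scalar V μ), scalar_mulVec, map_sub, map_smul, pow_succ]
    rfl
  have hk0 : ∀ j : Fin k, (f ^ k) (b ⟨0, j⟩) = 0 := fun j => by
    rw [hpow, dif_neg (by omega)]
  constructor
  · apply Matrix.toLin'.injective
    rw [map_zero]
    refine b.ext ?_
    rintro ⟨i, j⟩
    fin_cases i
    · refine (happ k _).trans ?_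
      have h2 := hk0 j
      rw [pow_succ', Module.End.mul_apply]
      change f ((f ^ k) (b ⟨0, j⟩)) - μ • (f ^ k) (b ⟨0, j⟩) = 0
      rw [h2, map_zero, smul_zero, sub_zero]
    · have hj : j = (0 : Fin 1) := Subsingleton.elim (α := Fin 1) j 0
      subst hj
      refine (happ k _).trans ?_
      rw [pow_succ, Module.End.mul_apply]
      change (f ^ k) (f (b ⟨1, (0 : Fin 1)⟩)) - μ • (f ^ k) (b ⟨1, (0 : Fin 1)⟩) = 0
      rw [h1, map_smul, sub_self]
  · intro h2
    -- On the first chain vector the product gives -μ times the last one, which is nonzero.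
    have h3 := happ (k - 1) (b ⟨0, (⟨0, hk⟩ : Fin k)⟩)
    rw [h2, map_zero, LinearMap.zero_apply, Nat.sub_add_cancel hk, hk0, hpow,
      dif_pos (by change 0 + (k - 1) < k; omega), zero_sub, eq_comm, neg_eq_zero] at h3
    exact (smul_ne_zero hμ (b.ne_zero _)) h3

theorem HasJordanForm.trace_eq (h : HasJordanForm M ![k, 1] ![0, μ]) : M.trace = μ := by
  obtain ⟨b, hb⟩ := h
  rw [← Matrix.trace_toLin'_eq, LinearMap.trace_eq_matrix_trace ℂ b, hb,
    Matrix.trace_blockDiagonal', Fin.sum_univ_two]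
  have h0 : Matrix.trace (jordanBlock k 0) = 0 := Finset.sum_eq_zero fun i _ => if_pos rfl
  have h1 : Matrix.trace (jordanBlock 1 μ) = μ := by
    simp [Matrix.trace, jordanBlock]
  exact (congrArg₂ (· + ·) h0 h1).trans (zero_add _)

theorem exists_eigenvector_iff_det : (∃ e : V → ℂ, e ≠ 0 ∧ Matrix.toLin' M e = μ • e) ↔
    (M - Matrix.scalar V μ).det = 0 := by
  rw [← Matrix.exists_mulVec_eq_zero_iff]
  refine exists_congr fun e => and_congr_right fun _ => ?_
  rw [Matrix.sub_mulVec, sub_eq_zero, Matrix.toLin'_apply, scalar_mulVec]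

/-- A vector x not killed by M^(k-1)(M - μ) gives a chain of length k starting at (M - μ)x, and the
determinant gives the eigenvector. These conditions, unlike a basis, pass easily to the transpose.
-/
theorem hasJordanForm_of_pow_mul_sub (hcard : Fintype.card V = k + 1) (hμ : μ ≠ 0)
    (h1 : M ^ k * (M - Matrix.scalar V μ) = 0) (h2 : M ^ (k - 1) * (M - Matrix.scalar V μ) ≠ 0)
    (hdet : (M - Matrix.scalar V μ).det = 0) : HasJordanForm M ![k, 1] ![0, μ] := by
  obtain ⟨e, he0, he⟩ := exists_eigenvector_iff_det.2 hdet
  obtain ⟨x, hx⟩ : ∃ x, (M ^ (k - 1) * (M - Matrix.scalar V μ)).mulVec x ≠ 0 := by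
    by_contra! h
    exact h2 (Matrix.toLin'.injective (LinearMap.ext fun x => by
      rw [Matrix.toLin'_apply, h, map_zero, LinearMap.zero_apply]))
  obtain ⟨b, -, hb⟩ := exists_basis_of_chain (M := M) hcard
    (c := (M - Matrix.scalar V μ).mulVec x)
    (by rw [← Matrix.toLin'_pow, Matrix.toLin'_apply, Matrix.mulVec_mulVec, h1,
      Matrix.zero_mulVec])
    (by rwa [← Matrix.toLin'_pow, Matrix.toLin'_apply, Matrix.mulVec_mulVec]) hμ he0 he
  exact ⟨b, hb⟩

theorem HasJordanForm.transpose (h : HasJordanForm M ![k, 1] ![0, μ])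
    (hcard : Fintype.card V = k + 1) (hk : 1 ≤ k) (hμ : μ ≠ 0) :
    HasJordanForm M.transpose ![k, 1] ![0, μ] := by
  obtain ⟨h1, h2⟩ := h.pow_mul_sub hk hμ
  have hc : ∀ r, M.transpose ^ r * (M.transpose - Matrix.scalar V μ) =
      (M ^ r * (M - Matrix.scalar V μ)).transpose := by
    intro r
    have hcomm : Commute (M ^ r) (M - Matrix.scalar V μ) :=
      ((Commute.refl M).sub_right (Matrix.scalar_commute μ (fun _ => Commute.all _ _) M).symm).pow_left r
    rw [hcomm.eq, Matrix.transpose_mul, Matrix.transpose_pow, Matrix.transpose_sub]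
    congr 2
    simp [Matrix.scalar_apply]
  refine hasJordanForm_of_pow_mul_sub hcard hμ (by rw [hc, h1, Matrix.transpose_zero])
    (fun h0 => h2 ?_) ?_
  · rw [hc] at h0
    rw [← Matrix.transpose_transpose (M ^ (k - 1) * _), h0, Matrix.transpose_zero]
  · have h3 := hc 0
    rw [pow_zero, pow_zero, one_mul, one_mul] at h3
    rw [h3, Matrix.det_transpose]
    obtain ⟨b, hb⟩ := h
    refine exists_eigenvector_iff_det.1 ⟨b ⟨1, (0 : Fin 1)⟩, b.ne_zero _,
      ((toMatrix_eq_jordan_iff b).1 hb).2⟩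

/-- If 0 were the only eigenvalue, the characteristic polynomial would be X^n and Cayley–Hamilton
would give M^n = 0. -/
theorem exists_eigenvalue_ne_zero (h : M ^ Fintype.card V ≠ 0) :
    ∃ μ : ℂ, μ ≠ 0 ∧ ∃ e : V → ℂ, e ≠ 0 ∧ Matrix.toLin' M e = μ • e := by
  by_contra! hcon
  apply h
  have hroots : M.charpoly.roots = Multiset.replicate (Multiset.card M.charpoly.roots) 0 := by
    rw [Multiset.eq_replicate]
    refine ⟨rfl, fun μ hμ => ?_⟩
    by_contra hne
    have hdet : (M - Matrix.scalar V μ).det = 0 := by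
      have h1 := (Polynomial.mem_roots'.1 hμ).2
      rw [Polynomial.IsRoot.def, Matrix.eval_charpoly] at h1
      rw [← neg_sub, Matrix.det_neg, h1, mul_zero]
    obtain ⟨e, he0, he⟩ := exists_eigenvector_iff_det.2 hdet
    exact hcon μ hne e he0 he
  have hsplit := IsAlgClosed.splits M.charpoly
  have hprod := hsplit.eq_prod_roots_of_monic M.charpoly_monic
  have hdeg : Multiset.card M.charpoly.roots = Fintype.card V := by
    rw [← hsplit.natDegree_eq_card_roots, Matrix.charpoly_natDegree_eq_dim]
  rw [hroots, hdeg, Multiset.map_replicate, Multiset.prod_replicate, map_zero, sub_zero] at hprod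
  have hCH := Matrix.aeval_self_charpoly M
  rwa [hprod, map_pow, Polynomial.aeval_X] at hCH

end JordanForm

/-! ### The arrow action over the integers and over the complex numbers -/

theorem cast_mulVec {V : Type*} [Fintype V] [DecidableEq V] (A : Matrix V V ℤ) (c : V → ℤ) :
    ((Int.castRingHom ℂ).mapMatrix A).mulVec (fun a => (c a : ℂ)) =
      fun a => ((A.mulVec c a : ℤ) : ℂ) := by
  ext a
  simp [Matrix.mulVec, dotProduct]

section ArrowAction

variable {V : Type u} [Quiver.{v + 1} V] [Fintype V] [∀ a b : V, Fintype (a ⟶ b)]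

theorem arrowAction_apply (a b : V) : arrowAction V b a = (Fintype.card (a ⟶ b) : ℤ) := rfl

theorem arrowAction_pos {a b : V} (α : a ⟶ b) : 0 < arrowAction V b a := by
  rw [arrowAction_apply, Nat.cast_pos]
  exact Fintype.card_pos_iff.2 ⟨α⟩

theorem arrowAction_of_isSink {a : V} (ha : IsSink a) (b : V) : arrowAction V b a = 0 := by
  have := ha b
  rw [arrowAction_apply, Fintype.card_eq_zero, Nat.cast_zero]

theorem trace_adjacency : (adjacency V).trace = (loopCount V : ℂ) := by
  simp [Matrix.trace, adjacency, loopCount]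

variable [DecidableEq V]

theorem arrowAction_pow_nonneg (k : ℕ) (a b : V) : 0 ≤ (arrowAction V ^ k) b a := by
  induction k generalizing b with
  | zero => rw [pow_zero, Matrix.one_apply]; split_ifs <;> simp
  | succ k ih =>
    rw [pow_succ', Matrix.mul_apply]
    exact Finset.sum_nonneg fun c _ => mul_nonneg (Int.natCast_nonneg _) (ih c)

/-- Entries of powers count walks, so there is no cancellation: a walk from `w` to `u` extends by
`α` before it and `β` after it. -/
theorem arrowAction_mul_pow_mul_pos {s t u w : V} (α : s ⟶ w) (β : u ⟶ t) {k : ℕ}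
    (h : (arrowAction V ^ k) u w ≠ 0) : 0 < (arrowAction V ^ (k + 2)) t s := by
  have h1 : 0 < (arrowAction V ^ (k + 1)) u s := by
    rw [pow_succ, Matrix.mul_apply]
    refine lt_of_lt_of_le (mul_pos ((arrowAction_pow_nonneg k w u).lt_of_ne' h)
      (arrowAction_pos α)) (Finset.single_le_sum (f := fun c =>
        (arrowAction V ^ k) u c * arrowAction V c s) (fun c _ => ?_) (Finset.mem_univ w))
    exact mul_nonneg (arrowAction_pow_nonneg k c u) (Int.natCast_nonneg _)
  rw [pow_succ', Matrix.mul_apply]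
  refine lt_of_lt_of_le (mul_pos (arrowAction_pos β) h1) (Finset.single_le_sum (f := fun c =>
      arrowAction V t c * (arrowAction V ^ (k + 1)) c s) (fun c _ => ?_) (Finset.mem_univ u))
  exact mul_nonneg (Int.natCast_nonneg _) (arrowAction_pow_nonneg (k + 1) s c)

theorem mapMatrix_arrowAction :
    (Int.castRingHom ℂ).mapMatrix (arrowAction V) = (adjacency V).transpose := by
  ext a b
  simp [arrowAction, adjacency]

theorem toLin'_transpose_adjacency_pow (k : ℕ) (c : V → ℤ) :
    (Matrix.toLin' (adjacency V).transpose ^ k) (fun a => (c a : ℂ)) =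
      fun a => (((arrowAction V ^ k).mulVec c a : ℤ) : ℂ) := by
  rw [← Matrix.toLin'_pow, ← mapMatrix_arrowAction, ← map_pow, Matrix.toLin'_apply, cast_mulVec]

theorem toLin'_transpose_adjacency_apply (x : V → ℂ) (b : V) :
    Matrix.toLin' (adjacency V).transpose x b = ∑ a, (Fintype.card (a ⟶ b) : ℂ) * x a := rfl

/-- A long chain of virtual semisimple modules under the syzygy operator determines the Jordan
form of the adjacency matrix, and excludes sources and sinks. -/
theorem jordan_of_long_chain {m : ℕ} {c : V → ℤ} (hV : 2 ≤ Fintype.card V)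
    (hm : Fintype.card V - 1 ≤ m) (hsource : ∀ a, IsSource a → c a = 0)
    {u : V} (hu : ¬ IsSink u) (hne : (arrowAction V ^ (m - 1)).mulVec c u ≠ 0)
    (hzero : ∀ a, ¬ IsSink a → (arrowAction V ^ m).mulVec c a = 0) :
    m = Fintype.card V - 1 ∧ (∀ a : V, ¬ IsSource a) ∧ (∀ a : V, ¬ IsSink a) ∧
      ∃ μ : ℂ, μ ≠ 0 ∧ HasJordanForm (adjacency V) ![Fintype.card V - 1, 1] ![0, μ] := by
  set f := Matrix.toLin' (adjacency V).transpose with hf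
  set C : V → ℂ := fun a => (c a : ℂ) with hC
  have hnz : (adjacency V).transpose ^ Fintype.card V ≠ 0 := by
    intro h0
    -- Some term of the sum gives a walk of length m - 1 from `w` to `u`. Here `w` is not a source,
    -- since c w ≠ 0, and `u` is not a sink, so the walk extends at both ends to length m + 1 ≥ n.
    obtain ⟨w, -, hw⟩ := Finset.exists_ne_zero_of_sum_ne_zero hne
    have hw1 : ¬ IsSource w := fun h => hw (by rw [hsource w h, mul_zero])
    obtain ⟨s, hs⟩ := not_forall.1 hw1
    obtain ⟨α⟩ := not_isEmpty_iff.1 hs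
    obtain ⟨t, ht⟩ := not_forall.1 hu
    obtain ⟨β⟩ := not_isEmpty_iff.1 ht
    have hpos := arrowAction_mul_pow_mul_pos α β (left_ne_zero_of_mul hw)
    have h1 : (adjacency V).transpose ^ (m - 1 + 2) = 0 := pow_eq_zero_of_le (by omega) h0
    rw [← mapMatrix_arrowAction, ← map_pow] at h1
    have h2 := congrFun (congrFun h1 t) s
    have h3 : (((arrowAction V ^ (m - 1 + 2)) t s : ℤ) : ℂ) = 0 := h2
    exact hpos.ne' (Int.cast_eq_zero.1 h3)
  obtain ⟨μ, hμ, e, he0, he⟩ := exists_eigenvalue_ne_zero hnz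
  have hTC : (f ^ (m - 1)) C u ≠ 0 := by
    rw [toLin'_transpose_adjacency_pow]
    exact Int.cast_ne_zero.2 hne
  -- The vector f^m C is supported on sinks, which `f` sends to zero; it need not vanish itself, so
  -- k may a priori be m + 1.
  have hTC1 : (f ^ (m + 1)) C = 0 := by
    rw [toLin'_transpose_adjacency_pow]
    funext b
    rw [pow_succ', ← Matrix.mulVec_mulVec]
    refine Int.cast_eq_zero.2 (Finset.sum_eq_zero fun a _ => ?_)
    change arrowAction V b a * _ = 0
    by_cases ha : IsSink a
    · rw [arrowAction_of_isSink ha, zero_mul]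
    · rw [hzero a ha, mul_zero]
  have hex : ∃ k, (f ^ k) C = 0 := ⟨_, hTC1⟩
  obtain ⟨k, hk, hkmin⟩ : ∃ k, (f ^ k) C = 0 ∧ ∀ j < k, (f ^ j) C ≠ 0 := by
    classical
    exact ⟨Nat.find hex, Nat.find_spec hex, fun j hj => Nat.find_min hex hj⟩
  have hmk : m - 1 < k := by
    by_contra! hle
    exact hTC (by rw [pow_apply_eq_zero_of_le hk hle]; rfl)
  have hk' : (f ^ (k - 1)) C ≠ 0 := hkmin _ (by omega)
  -- Independence gives k + 1 ≤ n, while n - 1 ≤ m ≤ k, so all are equalities.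
  have hcard := (linearIndependent_chainFamily hk hk' hμ he0 he).fintype_card_le_finrank
  rw [card_chain_index, Module.finrank_fintype_fun_eq_card] at hcard
  obtain rfl : k = m := by omega
  have hkV : Fintype.card V = k + 1 := by omega
  obtain ⟨b, hb, hjordan⟩ := exists_basis_of_chain hkV hk hk' hμ he0 he
  refine ⟨by omega, fun v hv => ?_, fun v hv => ?_, μ, hμ, ?_⟩
  · have hfv : ∀ x, f x v = 0 := fun x => by
      rw [hf, toLin'_transpose_adjacency_apply]
      refine Finset.sum_eq_zero fun a _ => ?_
      have := hv a
      rw [Fintype.card_eq_zero, Nat.cast_zero, zero_mul]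
    -- At a source every vector f x vanishes, and so do `c` by assumption and `e` because μ ≠ 0. The
    -- coordinate at `v` would be zero on a basis.
    have hproj : (LinearMap.proj v : (V → ℂ) →ₗ[ℂ] ℂ) = 0 := by
      refine b.ext fun x => ?_
      rw [hb, LinearMap.proj_apply, LinearMap.zero_apply, chainFamily]
      split_ifs
      · cases h : (x.2 : ℕ) with
        | zero =>
          change (c v : ℂ) = 0
          rw [hsource v hv, Int.cast_zero]
        | succ j => rw [pow_succ', Module.End.mul_apply]; exact hfv _
      · have h1 := congrFun he v
        rw [hfv] at h1
        exact (mul_eq_zero.1 h1.symm).resolve_left hμ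
    have h1 := LinearMap.congr_fun hproj (Pi.single v 1)
    simp at h1
  · have hfv : f (Pi.single v 1) = 0 := by
      funext d
      rw [hf, toLin'_transpose_adjacency_apply]
      refine Finset.sum_eq_zero fun a _ => ?_
      by_cases ha : a = v
      · subst ha
        have := hv d
        rw [Fintype.card_eq_zero, Nat.cast_zero, zero_mul]
      · rw [Pi.single_eq_of_ne ha, mul_zero]
    have hrepr := b.sum_repr (Pi.single v 1)
    rw [hb, sum_chainFamily] at hrepr
    -- The unit vector at a sink lies in ker f, hence is a multiple of f^(k-1) C. Comparing
    -- coordinates at the nonsink `u` makes that multiple zero.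
    have h1 : (f ^ 1) (∑ i : Fin k, b.repr (Pi.single v 1) ⟨0, i⟩ • (f ^ (i : ℕ)) C +
        b.repr (Pi.single v 1) ⟨1, (0 : Fin 1)⟩ • e) = 0 := by
      rw [pow_one, hrepr, hfv]
    obtain ⟨h2, h3⟩ := chain_coeff_eq_zero hk hk' hμ he0 he 1
      (fun i : Fin k => b.repr (Pi.single v 1) ⟨0, i⟩) _ h1
    have hk1 : k - 1 < k := by omega
    rw [h3, zero_smul, add_zero, Finset.sum_eq_single ⟨k - 1, hk1⟩] at hrepr
    · have huv : u ≠ v := fun h => hu (h ▸ hv)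
      have h4 := congrFun hrepr u
      rw [Pi.single_eq_of_ne huv, Pi.smul_apply, smul_eq_mul] at h4
      rw [(mul_eq_zero.1 h4).resolve_right hTC, zero_smul] at hrepr
      have h5 := congrFun hrepr v
      simp at h5
    · intro i _ hi
      have : (i : ℕ) ≠ k - 1 := fun h => hi (Fin.ext h)
      rw [h2 i (by omega), zero_smul]
    · simp
  · have hj : HasJordanForm (adjacency V).transpose ![k, 1] ![0, μ] := ⟨b, hjordan⟩
    have h1 := hj.transpose hkV (by omega) hμ
    rw [Matrix.transpose_transpose] at h1
    rwa [show Fintype.card V - 1 = k by omega]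

/-- The converse: a chain of virtual semisimple modules obtained from the Jordan form. -/
theorem exists_long_chain {μ : ℂ} (hV : 2 ≤ Fintype.card V) (hμ : μ ≠ 0)
    (h : HasJordanForm (adjacency V) ![Fintype.card V - 1, 1] ![0, μ]) :
    ∃ c : V → ℤ, (arrowAction V ^ (Fintype.card V - 2)).mulVec c ≠ 0 ∧
      (arrowAction V ^ (Fintype.card V - 1)).mulVec c = 0 := by
  obtain ⟨h1, h2⟩ := (h.transpose (by omega) (by omega) hμ).pow_mul_sub (by omega) hμ
  -- The trace makes μ an integer, so the complex matrix identities descend to ℤ and the chain can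
  -- be started at an integral vector.
  have htr : μ = ((loopCount V : ℤ) : ℂ) := by
    rw [← h.trace_eq, trace_adjacency, Int.cast_natCast]
  have hcast : ∀ r : ℕ, (adjacency V).transpose ^ r *
      ((adjacency V).transpose - Matrix.scalar V μ) = (Int.castRingHom ℂ).mapMatrix
        (arrowAction V ^ r * (arrowAction V - Matrix.scalar V (loopCount V : ℤ))) := by
    intro r
    rw [map_mul, map_pow, map_sub, mapMatrix_arrowAction]
    congr 2
    rw [htr]
    ext i j
    by_cases hij : i = j <;> simp [hij]
  rw [hcast] at h1 h2
  have hinj : Function.Injective ((Int.castRingHom ℂ).mapMatrix : Matrix V V ℤ → Matrix V V ℂ) :=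
    Matrix.map_injective Int.cast_injective
  have h3 : arrowAction V ^ (Fintype.card V - 1) *
      (arrowAction V - Matrix.scalar V (loopCount V : ℤ)) = 0 :=
    hinj (h1.trans (map_zero _).symm)
  have h4 : arrowAction V ^ (Fintype.card V - 1 - 1) *
      (arrowAction V - Matrix.scalar V (loopCount V : ℤ)) ≠ 0 := fun h0 =>
    h2 (by rw [h0, map_zero])
  obtain ⟨x, hx⟩ : ∃ x, (arrowAction V ^ (Fintype.card V - 1 - 1) *
      (arrowAction V - Matrix.scalar V (loopCount V : ℤ))).mulVec x ≠ 0 := by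
    by_contra! hcon
    exact h4 (Matrix.toLin'.injective (LinearMap.ext fun x => by
      rw [Matrix.toLin'_apply, hcon, map_zero, LinearMap.zero_apply]))
  refine ⟨(arrowAction V - Matrix.scalar V (loopCount V : ℤ)).mulVec x, ?_, ?_⟩
  · rwa [Matrix.mulVec_mulVec]
  · rw [Matrix.mulVec_mulVec, h3, Matrix.zero_mulVec]

end ArrowAction

/-! ### The φ-dimension -/

section PhiDim

variable {K : Type w} [Field K] {V : Type u} [Quiver.{v + 1} V] [Fintype V]
  [∀ a b : V, Fintype (a ⟶ b)] [DecidableEq V]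

/-- An element of `K₀` which is killed late by the syzygy operator. -/
theorem jordan_of_late_kernel (hV : 2 ≤ Fintype.card V) {z : K0 (RadSqZero K V)ᵐᵒᵖ} {m : ℕ}
    (hm : Fintype.card V - 1 ≤ m) (h : (omegaBar (R := (RadSqZero K V)ᵐᵒᵖ))^[m] z ≠ 0)
    (h' : (omegaBar (R := (RadSqZero K V)ᵐᵒᵖ))^[m + 1] z = 0) :
    m = Fintype.card V - 1 ∧ (∀ a : V, ¬ IsSource a) ∧ (∀ a : V, ¬ IsSink a) ∧
      ∃ μ : ℂ, μ ≠ 0 ∧ HasJordanForm (adjacency V) ![Fintype.card V - 1, 1] ![0, μ] := by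
  obtain ⟨c, hc, hsource⟩ := exists_omegaBar_eq_simpleClass z
  rw [Function.iterate_succ_apply, hc, omegaBar_iterate_simpleClass] at h'
  obtain ⟨j, rfl⟩ : ∃ j, m = j + 1 := ⟨m - 1, by omega⟩
  rw [Function.iterate_succ_apply, hc, omegaBar_iterate_simpleClass] at h
  obtain ⟨u, hu, hne⟩ : ∃ u, ¬ IsSink u ∧ (arrowAction V ^ j).mulVec c u ≠ 0 := by
    by_contra! hcon
    exact h (simpleClass_eq_zero_of_isSink hcon)
  exact jordan_of_long_chain hV hm hsource hu hne fun a ha => eq_zero_of_simpleClass_eq_zero h' ha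

/-- A kernel element first killed after m ≥ n steps would satisfy m = n - 1 by
`jordan_of_late_kernel`. -/
theorem phiDim_le_card (hV : 2 ≤ Fintype.card V) :
    phiDim (RadSqZero K V)ᵐᵒᵖ ≤ (Fintype.card V : ℕ∞) := by
  refine iSup_le fun M => phi_le (fun z m hm h => ?_) M
  by_contra hne
  have := (jordan_of_late_kernel hV (by omega) hne h).1
  omega

end PhiDim

theorem phiDim_eq_card_iff_and_eigenvalue (K : Type w) [Field K] (V : Type u)
    [Quiver.{v + 1} V] [Fintype V] [DecidableEq V] [∀ a b : V, Fintype (a ⟶ b)]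
    (hn : 2 ≤ Fintype.card V) :
    (phiDim (RadSqZero K V)ᵐᵒᵖ = (Fintype.card V : ℕ∞) ↔
      member K V = ∅ ∧ ∃ μ : ℂ, μ ≠ 0 ∧
        HasJordanForm (adjacency V)
          ![Fintype.card V - 1, 1] ![0, μ]) ∧
    ∀ μ : ℂ, μ ≠ 0 →
      HasJordanForm (adjacency V)
        ![Fintype.card V - 1, 1] ![0, μ] →
      μ = (loopCount V : ℂ) := by
  refine ⟨⟨fun h => ?_, fun ⟨hmem, μ, hμ, hJ⟩ => ?_⟩, fun μ _ hJ => ?_⟩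
  -- If no new kernel appears from level n - 1 on, then φdim(A) ≤ n - 1, so the value n forces a
  -- late kernel element.
  · by_cases hcon : ∀ (z : K0 (RadSqZero K V)ᵐᵒᵖ) (m : ℕ), Fintype.card V - 1 ≤ m →
      (omegaBar (R := (RadSqZero K V)ᵐᵒᵖ))^[m + 1] z = 0 →
        (omegaBar (R := (RadSqZero K V)ᵐᵒᵖ))^[m] z = 0
    · have hle : phiDim (RadSqZero K V)ᵐᵒᵖ ≤ ((Fintype.card V - 1 : ℕ) : ℕ∞) :=
        iSup_le fun M => phi_le hcon M
      rw [h, Nat.cast_le] at hle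
      omega
    · push Not at hcon
      obtain ⟨z, m, hm, hz, hz'⟩ := hcon
      obtain ⟨-, h1, h2, h3⟩ := jordan_of_late_kernel hn hm hz' hz
      exact ⟨(member_eq_empty_iff K V).2 ⟨h1, h2⟩, h3⟩
  · obtain ⟨hsource, hsink⟩ := (member_eq_empty_iff K V).1 hmem
    refine le_antisymm (phiDim_le_card hn) ?_
    obtain ⟨c, hc, hc'⟩ := exists_long_chain hn hμ hJ
    obtain ⟨M, hM⟩ := exists_module_omegaBar_surjective (K := K) hsource
    obtain ⟨x, hx, hxc⟩ := hM c
    obtain ⟨k, hk⟩ : ∃ k, Fintype.card V = k + 2 := ⟨Fintype.card V - 2, by omega⟩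
    rw [hk, show k + 2 - 2 = k by omega] at hc
    rw [hk, show k + 2 - 1 = k + 1 by omega] at hc'
    -- Here n = k + 2. The chain `c` survives k steps and dies at step k + 1; since it represents
    -- Ω̄x, the element `x` survives one step more.
    have hle : ((k + 1 + 1 : ℕ) : ℕ∞) ≤ phi M := by
      refine le_phi hx (fun h0 => hc ?_) ?_
      · rw [Function.iterate_succ_apply, hxc, omegaBar_iterate_simpleClass] at h0
        exact funext fun a => eq_zero_of_simpleClass_eq_zero h0 (hsink a)
      · rw [Function.iterate_succ_apply, hxc, omegaBar_iterate_simpleClass, hc', map_zero]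
    rw [hk]
    exact hle.trans (le_iSup (fun M => phi M) M)
  · rw [← hJ.trace_eq, trace_adjacency]

end QuiverAlgebra

theorem theorem4p24 (K : Type w) [Field K] (V : Type u) [Quiver.{v + 1} V] [Fintype V]
    [DecidableEq V] [∀ a b : V, Fintype (a ⟶ b)]
    (hconn : Subsingleton (Quiver.WeaklyConnectedComponent V)) (hn : 2 ≤ Fintype.card V) :
    (IgusaTodorov.phiDim (QuiverAlgebra.RadSqZero K V)ᵐᵒᵖ = (Fintype.card V : ℕ∞) ↔
      QuiverAlgebra.member K V = ∅ ∧ ∃ μ : ℂ, μ ≠ 0 ∧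
        QuiverAlgebra.HasJordanForm (QuiverAlgebra.adjacency V)
          ![Fintype.card V - 1, 1] ![0, μ]) ∧
    ∀ μ : ℂ, μ ≠ 0 →
      QuiverAlgebra.HasJordanForm (QuiverAlgebra.adjacency V)
        ![Fintype.card V - 1, 1] ![0, μ] →
      μ = (QuiverAlgebra.loopCount V : ℂ) :=
  QuiverAlgebra.phiDim_eq_card_iff_and_eigenvalue K V hn
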